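/- **Notation.** Let $x=r\cos\theta$, $y=r\sin\theta$. All polynomials in $x,y$ have complex coefficients. Put $\nabla p=(\partial_x p,\partial_y p)^\top$ and $\operatorname{curl}(f_1,f_2)^\top=\partial_x f_2-\partial_y f_1$. Let $P_n^{(a,b)}$ be the Jacobi polynomials. For $m\in\mathbb Z$, $j\ge 0$ let $$y_m=(x+i\,\mathrm{sign}(m)\,y)^{|m|}=r^{|m|}e^{im\theta},\quad z^{(a)}_{mj}=P_j^{(a,|m|)}(2r^2-1)\,y_m,\quad z_{mj}=z^{(0)}_{mj},\quad w_{mj}=(1-r^2)z^{(1)}_{mj}.$$ For $n,b\ge 0$ let $\mathfrak r_n^{(b)}=10n^2+n(13b+19)+4(b+1)(b+2)$, $$\mathbf v_n^{(b)}(t)=\begin{pmatrix}(b+1)(1-t)P_n^{(1,b+1)}(2t-1)-2t(n+1)P_n^{(0,b+2)}(2t-1)\\(b+1)P_n^{(1,b+1)}(2t-1)\end{pmatrix},$$ $$\mathbf q_n^{(b),1}(t)=\frac{2n+b+1}{(n+1)\mathfrak r_n^{(b)}}\left[(2n+b+2)(2n+b+3)P_n^{(1,b)}(2t-1)\begin{pmatrix}1-t\\1\end{pmatrix}-(n+b+2)\mathbf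 v_n^{(b)}(t)\right],$$ and, for $n\ge1$, $\mathbf q_n^{(b),2}(t)=-\tfrac1n\mathbf v_{n-1}^{(b)}(t)-\mathbf q_n^{(b),1}(t)$. With $N(x,y)=\begin{pmatrix}1-y^2&xy\\xy&1-x^2\end{pmatrix}$ and the rotation matrix $\rho(\theta)$ let $$\mathbf n_{0j}^1=N\,P_{j-1}^{(0,1)}(2r^2-1)\begin{pmatrix}x\\y\end{pmatrix},\qquad \mathbf n_{0j}^2=N\,P_{j-1}^{(1,1)}(2r^2-1)\begin{pmatrix}-y\\x\end{pmatrix}\qquad(j\ge1),$$ $$\mathbf n_{mj}^\nu=N\,r^{|m|-1}e^{im\theta}\rho(\theta)\begin{pmatrix}1&0\\0&i\,\mathrm{sign}(m)\end{pmatrix}\mathbf q_j^{(|m|-1),\nu}(r^2)\qquad(m\neq0,\ j\ge0\text{ if }\nu=1,\ j\ge1\text{ if }\nu=2),$$ which are vector polynomials in $x,y$. Finally let $\mathbf n_{0j}^+=2\mathbf n_{0j}^1$ and $\mathbf n_{0j}^-=2\mathbf n_{0j}^2$ for $j\ge1$, and for $m\ne0$ let $\mathbf n_{m0}^-=2\mathbf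 n_{m0}^1$ and $\mathbf n_{mj}^\pm=\mathbf n_{mj}^1\pm\mathbf n_{mj}^2$ for $j\ge1$. Let $\mathcal V$ be the space of polynomials that vanish on the unit circle and $\mathcal N$ the space of vector polynomials $\mathbf f$ with $\mathbf f\cdot(-y,x)=0$ on the unit circle. The polynomial de Rham complex with boundary conditions on the disk is $0\to\mathcal V\xrightarrow{\nabla}\mathcal N\xrightarrow{\operatorname{curl}}\mathbb C[x,y]\to0$. **Theorem.** 1. For all $m\in\mathbb Z$ and $j\ge0$ the complex $$0\to\operatorname{span}\{w_{mj}\}\xrightarrow{\nabla}\operatorname{span}\{\mathbf n^+_{m,j+1},\mathbf n^-_{m,j+1}\}\xrightarrow{\operatorname{curl}}\operatorname{span}\{z_{m,j+1}\}\to0$$ is well defined and exact. 2. For all $m\ne0$ the complex $0\to0\to\operatorname{span}\{\mathbf n^-_{m0}\}\xrightarrow{\operatorname{curl}}\operatorname{span}\{z_{m0}\}\to0$ is well defined and exact. 3. The $w_{mj}$ ($m\in\mathbb Z$, $j\ge0$) form a basis of $\mathcal V$; the $\mathbf n_{mj}^+$ ($m\in\mathbb Z$, $j\ge1$) together with the $\mathbf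 n_{mj}^-$ ($m\in\mathbb Z$, $j\ge0$, $(m,j)\ne(0,0)$) form a basis of $\mathcal N$; the $z_{mj}$ ($m\in\mathbb Z$, $j\ge0$) form a basis of $\mathbb C[x,y]$. 4. The polynomial de Rham complex is the direct sum of the complexes in 1 (over all $m\in\mathbb Z$, $j\ge0$), those in 2 (over all $m\neq0$), and the complex $0\to0\to0\to\operatorname{span}\{z_{00}\}\to0$. 5. $\operatorname{span}\{z_{00}\}$ is the space of constants, and $\mathbb C[x,y]=\operatorname{curl}(\mathcal N)\oplus\operatorname{span}\{z_{00}\}$. -/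

import Mathlib

namespace DeRhamDisk

noncomputable section

open MvPolynomial

/-- Complex polynomials in the two real coordinates `x = X 0` and `y = X 1`. -/
abbrev Scal := MvPolynomial (Fin 2) ℂ

/-- Complex vector polynomials on the plane (columns of length two). -/
abbrev Vec := Fin 2 → Scal

/-- The polynomial `r ^ 2 = x ^ 2 + y ^ 2`. -/
def rsq : Scal := X 0 ^ 2 + X 1 ^ 2

/-- The gradient `p ↦ (∂ₓ p, ∂_y p)`. -/
def grad : Scal →ₗ[ℂ] Vec :=
  LinearMap.pi fun i => (pderiv i : Derivation ℂ Scal Scal).toLinearMap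

/-- The two-dimensional curl `f ↦ ∂ₓ f₂ - ∂_y f₁`. -/
def curl : Vec →ₗ[ℂ] Scal :=
  (pderiv 0 : Derivation ℂ Scal Scal).toLinearMap ∘ₗ LinearMap.proj 1 -
    (pderiv 1 : Derivation ℂ Scal Scal).toLinearMap ∘ₗ LinearMap.proj 0

/-- Scalar polynomials that vanish on the unit circle. -/
def vanishing : Submodule ℂ Scal where
  carrier := {p | ∀ x y : ℝ, x ^ 2 + y ^ 2 = 1 → eval ![(x : ℂ), (y : ℂ)] p = 0}
  zero_mem' := by intro x y _; simp
  add_mem' := by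
    intro p q hp hq x y h
    simp [hp x y h, hq x y h]
  smul_mem' := by
    intro c p hp x y h
    simp [smul_eval, hp x y h]

/-- Vector polynomials that are normal on the unit circle: `f · (-y, x) = 0` there. -/
def normal : Submodule ℂ Vec where
  carrier := {f | ∀ x y : ℝ, x ^ 2 + y ^ 2 = 1 →
    -(y : ℂ) * eval ![(x : ℂ), (y : ℂ)] (f 0) + (x : ℂ) * eval ![(x : ℂ), (y : ℂ)] (f 1) = 0}
  zero_mem' := by intro x y _; simp
  add_mem' := by
    intro p q hp hq x y h
    have h1 := hp x y h
    have h2 := hq x y h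
    simp only [Pi.add_apply, map_add]
    linear_combination h1 + h2
  smul_mem' := by
    intro c p hp x y h
    have h1 := hp x y h
    simp only [Pi.smul_apply, smul_eval]
    linear_combination c * h1

/-- The Jacobi polynomial `P_n^{(a,b)}` for natural parameters `a, b`:
`P_n^{(a,b)}(x) = ∑_{l ≤ n} C(n+a, l) C(n+b, n-l) ((x-1)/2)^(n-l) ((x+1)/2)^l`. -/
def jacobi (n a b : ℕ) : Polynomial ℂ :=
  ∑ l ∈ Finset.range (n + 1),
    Polynomial.C (((n + a).choose l * (n + b).choose (n - l) : ℕ) : ℂ) *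
      (Polynomial.C (1 / 2) * (Polynomial.X - 1)) ^ (n - l) *
      (Polynomial.C (1 / 2) * (Polynomial.X + 1)) ^ l

/-- The shifted Jacobi polynomial `t ↦ P_n^{(a,b)}(2t - 1)`. -/
def sjacobi (n a b : ℕ) : Polynomial ℂ :=
  (jacobi n a b).comp (2 * Polynomial.X - 1)

/-- The number `i sign m`. -/
def isgn (m : ℤ) : ℂ := Complex.I * (m.sign : ℂ)

/-- The harmonic polynomial `y_m = r^|m| e^{imθ} = (x + sign(m) i y)^|m|`. -/
def harm (m : ℤ) : Scal := (X 0 + C (isgn m) * X 1) ^ m.natAbs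

/-- The generalised Zernike polynomial `z_{mj}^{(a)} = P_j^{(a,|m|)}(2r² - 1) y_m`. -/
def zernikeGen (a : ℕ) (m : ℤ) (j : ℕ) : Scal :=
  Polynomial.aeval rsq (sjacobi j a m.natAbs) * harm m

/-- The Zernike polynomial `z_{mj} = z_{mj}^{(0)}`. -/
def zernike (m : ℤ) (j : ℕ) : Scal := zernikeGen 0 m j

/-- The weighted Zernike polynomial `w_{mj} = (1 - r²) z_{mj}^{(1)}`. -/
def wzernike (m : ℤ) (j : ℕ) : Scal := (1 - rsq) * zernikeGen 1 m j

/-- The constant `10 n² + n (13 b + 19) + 4 (b + 1) (b + 2)`. -/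
def rconst (n b : ℕ) : ℂ := 10 * n ^ 2 + n * (13 * b + 19) + 4 * (b + 1) * (b + 2)

/-- The auxiliary univariate vector polynomial `v_n^{(b)}(t)`. -/
def vaux (n b : ℕ) : Fin 2 → Polynomial ℂ :=
  ![((b : ℂ) + 1) • ((1 - Polynomial.X) * sjacobi n 1 (b + 1)) -
      (2 * ((n : ℂ) + 1)) • (Polynomial.X * sjacobi n 0 (b + 2)),
    ((b : ℂ) + 1) • sjacobi n 1 (b + 1)]

/-- The univariate vector polynomial `q_n^{(b),1}(t)`. -/
def q1 (n b : ℕ) : Fin 2 → Polynomial ℂ :=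
  ((2 * (n : ℂ) + b + 1) / (((n : ℂ) + 1) * rconst n b)) •
    (((2 * (n : ℂ) + b + 2) * (2 * (n : ℂ) + b + 3)) •
        ![sjacobi n 1 b * (1 - Polynomial.X), sjacobi n 1 b] -
      ((n : ℂ) + b + 2) • vaux n b)

/-- The univariate vector polynomial `q_n^{(b),2}(t) = -v_{n-1}^{(b)}(t) / n - q_n^{(b),1}(t)`,
`n ≥ 1`, with the convention `q_0^{(b),2} = 0`. -/
def q2 : ℕ → ℕ → Fin 2 → Polynomial ℂ
  | 0, _ => 0
  | n + 1, b => -((1 / ((n : ℂ) + 1)) • vaux n b) - q1 (n + 1) b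

/-- The equivariant matrix `Σ(x, y)`. -/
def sigmaMat : Matrix (Fin 2) (Fin 2) Scal :=
  !![X 0 ^ 2 - X 1 ^ 2, 2 * X 0 * X 1; 2 * X 0 * X 1, X 1 ^ 2 - X 0 ^ 2]

/-- The matrix weight `N(x, y)`, which annihilates the tangential direction on the unit circle. -/
def normalMat : Matrix (Fin 2) (Fin 2) Scal :=
  !![1 - X 1 ^ 2, X 0 * X 1; X 0 * X 1, 1 - X 0 ^ 2]

/-- The vector analogue of the harmonic polynomials for `m ≠ 0`:
`r^(|m|-1) e^{imθ} (e_r + i sign(m) e_θ) = (x + sign(m) i y)^(|m|-1) (1, i sign m)`. -/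
def vharm (m : ℤ) : Vec :=
  ((X 0 + C (isgn m) * X 1) ^ (m.natAbs - 1) : Scal) • (![1, C (isgn m)] : Vec)

/-- The map `𝒫_m`, `m ≠ 0`, from univariate vector polynomials `f(t) = (f₁(t), f₂(t))` with
`f₁(0) = f₂(0)` to vector polynomials on the plane of mode `m`. It is the linear map with
`tⁿ (1, 1) ↦ r^(2n) y_m` and, for `n ≥ 1`, `tⁿ (1, -1) ↦ r^(2n-2) Σ y_m`, where `y_m` is the
vector `vharm m`. In polar coordinates it is
`f ↦ r^(|m|-1) e^{imθ} ρ(θ) diag(1, i sign m) f(r²)`, see `pmap_polar`. -/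
def pmap (m : ℤ) (f : Fin 2 → Polynomial ℂ) : Vec :=
  Polynomial.aeval rsq (Polynomial.C (1 / 2) * (f 0 + f 1)) • vharm m +
    Polynomial.aeval rsq (Polynomial.divX (Polynomial.C (1 / 2) * (f 0 - f 1))) •
      (sigmaMat.mulVec (vharm m))

/-- The polar form of `pmap`: at `(r cos θ, r sin θ)` the value is
`r^(|m|-1) e^{imθ} ρ(θ) diag(1, i sign m) f(r²)`. -/
theorem pmap_polar (m : ℤ) (hm : m ≠ 0) (f : Fin 2 → Polynomial ℂ)
    (hf : (f 0).eval 0 = (f 1).eval 0) (r θ : ℝ) :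
    (fun i => eval ![((r * Real.cos θ : ℝ) : ℂ), ((r * Real.sin θ : ℝ) : ℂ)] (pmap m f i)) =
      ((r : ℂ) ^ (m.natAbs - 1) * Complex.exp (Complex.I * m * θ)) •
        (!![(Real.cos θ : ℂ), -(Real.sin θ : ℂ); (Real.sin θ : ℂ), (Real.cos θ : ℂ)] *
          !![1, 0; 0, isgn m]).mulVec
          ![(f 0).eval ((r : ℂ) ^ 2), (f 1).eval ((r : ℂ) ^ 2)] := by
  have hs : isgn m * isgn m = -1 := by
    rcases lt_or_gt_of_ne hm with h | h
    · simp [isgn, Int.sign_eq_neg_one_of_neg h]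
    · simp [isgn, Int.sign_eq_one_of_pos h]
  have hcs : (Real.cos θ : ℂ) ^ 2 + (Real.sin θ : ℂ) ^ 2 = 1 := by
    exact_mod_cast Real.cos_sq_add_sin_sq θ
  have hE : Complex.exp (Complex.I * m * θ) =
      ((Real.cos θ : ℂ) + isgn m * (Real.sin θ : ℂ)) ^ (m.natAbs - 1 + 1) := by
    have hk : m.natAbs - 1 + 1 = m.natAbs := by omega
    have h1 : (Real.cos θ : ℂ) + isgn m * (Real.sin θ : ℂ) =
        Complex.exp (isgn m * θ) := by
      rcases lt_or_gt_of_ne hm with h | h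
      · simp only [isgn, Int.sign_eq_neg_one_of_neg h, Complex.ofReal_cos, Complex.ofReal_sin]
        have := Complex.exp_mul_I (-(θ : ℂ))
        rw [Complex.cos_neg, Complex.sin_neg] at this
        push_cast
        rw [show Complex.I * -1 * (θ : ℂ) = -(θ : ℂ) * Complex.I by ring, this]
        ring
      · simp only [isgn, Int.sign_eq_one_of_pos h, Complex.ofReal_cos, Complex.ofReal_sin]
        have := Complex.exp_mul_I (θ : ℂ)
        push_cast
        rw [show Complex.I * 1 * (θ : ℂ) = (θ : ℂ) * Complex.I by ring, this]
        ring
    rw [hk, h1, ← Complex.exp_nat_mul]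
    congr 1
    have h2 : ((m.natAbs : ℤ) : ℂ) * ((m.sign : ℤ) : ℂ) = (m : ℂ) := by
      rw [← Int.cast_mul, mul_comm, Int.sign_mul_natAbs]
    rw [Int.cast_natCast] at h2
    rw [isgn, ← h2]
    ring
  set c : ℂ := (Real.cos θ : ℂ) with hc
  set d : ℂ := (Real.sin θ : ℂ) with hd
  have hpt : ![((r * Real.cos θ : ℝ) : ℂ), ((r * Real.sin θ : ℝ) : ℂ)] =
      ![(r : ℂ) * c, (r : ℂ) * d] := by
    rw [Complex.ofReal_mul, Complex.ofReal_mul]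
  have hev : ∀ p : Polynomial ℂ, eval ![(r : ℂ) * c, (r : ℂ) * d] (Polynomial.aeval rsq p) =
      p.eval ((r : ℂ) ^ 2) := by
    intro p
    have h1 : eval ![(r : ℂ) * c, (r : ℂ) * d] rsq = (r : ℂ) ^ 2 := by
      simp only [rsq, map_add, map_pow, eval_X, Matrix.cons_val_zero, Matrix.cons_val_one]
      linear_combination (r : ℂ) ^ 2 * hcs
    induction p using Polynomial.induction_on' with
    | add p q hp hq => simp only [map_add, hp, hq, Polynomial.eval_add]
    | monomial n a =>
      rw [Polynomial.aeval_monomial, map_mul, map_pow, h1, algebraMap_eq, eval_C,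
        Polynomial.eval_monomial]
  have hdiv : ((f 0 - f 1).divX).eval ((r : ℂ) ^ 2) * (r : ℂ) ^ 2 =
      (f 0).eval ((r : ℂ) ^ 2) - (f 1).eval ((r : ℂ) ^ 2) := by
    have h1 := congrArg (Polynomial.eval ((r : ℂ) ^ 2)) (Polynomial.divX_mul_X_add (f 0 - f 1))
    have h2 : (f 0 - f 1).coeff 0 = 0 := by
      rw [Polynomial.coeff_zero_eq_eval_zero, Polynomial.eval_sub, hf, sub_self]
    simpa [h2] using h1
  rw [hE, hpt, pow_succ (c + isgn m * d)]
  funext i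
  fin_cases i
  all_goals
    simp only [pmap, vharm, sigmaMat, Polynomial.divX_C_mul, Pi.add_apply, Pi.smul_apply,
      smul_eq_mul, map_add, map_mul, hev, Matrix.mulVec, dotProduct, Fin.sum_univ_two,
      Matrix.mul_apply, Fin.zero_eta, Fin.mk_one, Matrix.of_apply, Matrix.cons_val_zero,
      Matrix.cons_val_one, Matrix.cons_val', Matrix.cons_val_fin_one, map_pow, map_sub, eval_X,
      eval_C, map_ofNat, Polynomial.eval_C, mul_one, mul_zero, add_zero, zero_add]
    rw [show (r : ℂ) * c + isgn m * ((r : ℂ) * d) = r * (c + isgn m * d) by ring, mul_pow]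
    generalize ((f 0 - f 1).divX).eval ((r : ℂ) ^ 2) = D at *
    generalize (f 0).eval ((r : ℂ) ^ 2) = a at *
    generalize (f 1).eval ((r : ℂ) ^ 2) = b at *
    generalize isgn m = s at *
    generalize (c + s * d) ^ (m.natAbs - 1) = P at *
    generalize (r : ℂ) ^ (m.natAbs - 1) = R at *
  · linear_combination (1 / 2 * (c ^ 2 - d ^ 2 + 2 * c * d * s) * R * P) * hdiv -
      (R * P * (a + b) / 2) * hcs + (R * P * b * d ^ 2) * hs
  · linear_combination (1 / 2 * (2 * c * d + (d ^ 2 - c ^ 2) * s) * R * P) * hdiv -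
      (R * P * s * (a + b) / 2) * hcs - (R * P * b * c * d) * hs

/-- The vector orthogonal polynomials `v_{mj}^{N,1}`; for `m = 0` only `j ≥ 1` is meaningful. -/
def vN1 (m : ℤ) (j : ℕ) : Vec :=
  if m = 0 then Polynomial.aeval rsq (sjacobi (j - 1) 0 1) • ![X 0, X 1]
  else pmap m (q1 j (m.natAbs - 1))

/-- The vector orthogonal polynomials `v_{mj}^{N,2}`; only `j ≥ 1` is meaningful. -/
def vN2 (m : ℤ) (j : ℕ) : Vec :=
  if m = 0 then Polynomial.aeval rsq (sjacobi (j - 1) 1 1) • ![-X 1, X 0]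
  else pmap m (q2 j (m.natAbs - 1))

/-- `n_{mj}^1 = N v_{mj}^{N,1}`. -/
def n1 (m : ℤ) (j : ℕ) : Vec := normalMat.mulVec (vN1 m j)

/-- `n_{mj}^2 = N v_{mj}^{N,2}`. -/
def n2 (m : ℤ) (j : ℕ) : Vec := normalMat.mulVec (vN2 m j)

/-- `n_{mj}^+`, defined for `j ≥ 1`: `2 n_{0j}^1` for `m = 0`, and `n_{mj}^1 + n_{mj}^2` for
`m ≠ 0`. -/
def nPlus (m : ℤ) (j : ℕ) : Vec :=
  if m = 0 then (2 : ℂ) • n1 m j else n1 m j + n2 m j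

/-- `n_{mj}^-`, defined for `j ≥ 1` and, if `m ≠ 0`, also for `j = 0`: `2 n_{0j}^2` for `m = 0`,
`2 n_{m0}^1` for `m ≠ 0` and `j = 0`, and `n_{mj}^1 - n_{mj}^2` for `m ≠ 0` and `j ≥ 1`. -/
def nMinus (m : ℤ) (j : ℕ) : Vec :=
  if m = 0 then (2 : ℂ) • n2 m j
  else if j = 0 then (2 : ℂ) • n1 m j
  else n1 m j - n2 m j

/-- The sequence `0 → A → B → C → 0` of spaces of polynomials, with maps the restrictions of
`grad` and `curl`, is well defined and exact. -/
def IsExactSubcomplex (A : Submodule ℂ Scal) (B : Submodule ℂ Vec) (C : Submodule ℂ Scal) : Prop :=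
  ∃ (h₁ : ∀ u ∈ A, grad u ∈ B) (h₂ : ∀ f ∈ B, curl f ∈ C),
    Function.Injective (grad.restrict h₁) ∧
    Function.Exact (grad.restrict h₁) (curl.restrict h₂) ∧
    Function.Surjective (curl.restrict h₂)

/-- Labels of the sub-complexes: one for every mode `m` and `j ≥ 0`, an extra one for every
`m ≠ 0`, and the one formed by the constants. -/
inductive Piece : Type
  | main (m : ℤ) (j : ℕ) : Piece
  | extra (m : ℤ) (hm : m ≠ 0) : Piece
  | const : Piece

/-- The first space of each sub-complex. -/
def piece0 : Piece → Submodule ℂ Scal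
  | .main m j => Submodule.span ℂ {wzernike m j}
  | .extra _ _ => ⊥
  | .const => ⊥

/-- The second space of each sub-complex. -/
def piece1 : Piece → Submodule ℂ Vec
  | .main m j => Submodule.span ℂ {nPlus m (j + 1), nMinus m (j + 1)}
  | .extra m _ => Submodule.span ℂ {nMinus m 0}
  | .const => ⊥

/-- The third space of each sub-complex. -/
def piece2 : Piece → Submodule ℂ Scal
  | .main m j => Submodule.span ℂ {zernike m (j + 1)}
  | .extra m _ => Submodule.span ℂ {zernike m 0}
  | .const => Submodule.span ℂ {zernike 0 0}

/-- The family of all `n_{mj}^+` (`m ∈ ℤ`, `j ≥ 1`) and all `n_{mj}^-`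
(`m ∈ ℤ`, `j ≥ 0`, `(m, j) ≠ (0, 0)`). -/
def nFamily : (ℤ × ℕ) ⊕ {p : ℤ × ℕ // p ≠ (0, 0)} → Vec :=
  Sum.elim (fun p => nPlus p.1 (p.2 + 1)) (fun p => nMinus p.1.1 p.1.2)

end

end DeRhamDisk

namespace DeRhamDisk

noncomputable section

/-! ### Shifted Jacobi polynomials: two derivative identities and the degree. -/

section Jacobi

open Polynomial

/-! The definitions of the vector polynomials reduce everything to two facts: `n_{m,j+1}^+` is a
nonzero multiple of the gradient of `w_{mj}` (`nPlus_succ`), and the curl of `n_{mj}^-` is a nonzero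
multiple of `z_{mj}` (`exists_curl_nMinus`). For `m ≠ 0` the matrix `N` keeps the radial component
and multiplies the angular one by `1 - r²`. Hence `N 𝒫_m v_n` is the gradient of `w_{mn}`, and `N
𝒫_m` of the remaining part of `q_n^1` is a radial multiple of `vharm m`, whose curl is a derivative
of a Jacobi polynomial. Each small complex is then exact by inspection (`isExactSubcomplex_of`).

For the bases, polynomials split uniquely into modes `p_m(r²) y_m`, and in each mode the Jacobi
polynomials have one element per degree; this gives the `z_{mj}`. Vanishing on the circle means
divisibility by `1 - r²` (`one_sub_rsq_dvd_of_mem_vanishing`); this gives the `w_{mj}`.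

Independence in the space of normal fields holds because the `n^+` are images of the `w` under an
injective map and lie in the kernel of the curl, while the `n^-` have independent curls. For
spanning, a combination of the `n^-` corrects the curl of a normal field to a constant. By
`exists_grad_of_curl_eq_C` this constant is zero and the corrected field is the gradient of a
polynomial vanishing on the circle: a potential would otherwise grow linearly in the angle. The
direct sums follow by grouping the bases. -/

theorem sjacobi_eq_sum (n a b : ℕ) :
    sjacobi n a b = ∑ l ∈ Finset.range (n + 1),
      C (((n + a).choose l * (n + b).choose (n - l) : ℕ) : ℂ) * ((X - 1) ^ (n - l) * X ^ l) := by
  have h : C (1 / 2 : ℂ) * 2 = 1 := by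
    rw [show (2 : ℂ[X]) = C 2 from rfl, ← C_mul]; norm_num
  rw [sjacobi, jacobi, ← coe_compRingHom_apply, map_sum]
  refine Finset.sum_congr rfl fun l _ => ?_
  simp only [map_mul, map_pow, coe_compRingHom_apply, C_comp, sub_comp, add_comp, X_comp, one_comp]
  rw [show C (1 / 2 : ℂ) * (2 * X - 1 - 1) = X - 1 by linear_combination (X - 1) * h,
    show C (1 / 2 : ℂ) * (2 * X - 1 + 1) = X by linear_combination X * h, mul_assoc]

/-- The truncated exponent `b - 1` is harmless at `b = 0`, where its factor is zero. -/
theorem derivative_sub_one_pow_mul_X_pow (a b : ℕ) :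
    derivative ((X - 1 : ℂ[X]) ^ (a + 1) * X ^ b) =
      ((a : ℂ[X]) + 1) * ((X - 1) ^ a * X ^ b) +
        (b : ℂ[X]) * ((X - 1) ^ (a + 1) * X ^ (b - 1)) := by
  simp only [derivative_mul, derivative_pow, derivative_sub, derivative_X, derivative_one,
    Nat.add_sub_cancel, map_natCast]
  push_cast
  ring

theorem one_sub_mul_sjacobi (n b : ℕ) :
    (1 - X) * sjacobi n 1 b = -∑ l ∈ Finset.range (n + 1),
      C (((n + 1).choose l * (n + b).choose (n - l) : ℕ) : ℂ) *
        ((X - 1) ^ (n - l + 1) * X ^ l) := by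
  rw [sjacobi_eq_sum, ← neg_sub X, neg_mul, Finset.mul_sum]
  congr 1
  refine Finset.sum_congr rfl fun l _ => ?_
  ring

/-- Two consecutive summands contribute to each `(X - 1)^(n-l) X^l`; absorption turns both outer
factors into `(n+1) C(n,l)`, and Pascal's rule adds the rest. The identity governs both the gradient
of `w_{mn}` and the curl of `n_{mj}^-` for `m ≠ 0`. -/
theorem derivative_one_sub_mul_sjacobi (n b : ℕ) :
    derivative ((1 - X) * sjacobi n 1 b) = -((n : ℂ[X]) + 1) * sjacobi n 0 (b + 1) := by
  rw [one_sub_mul_sjacobi, derivative_neg, derivative_sum, neg_mul, neg_inj, sjacobi_eq_sum,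
    Finset.mul_sum]
  simp only [derivative_C_mul, derivative_sub_one_pow_mul_X_pow, mul_add, Finset.sum_add_distrib]
  rw [Finset.sum_range_succ' (fun l => C _ * ((l : ℂ[X]) * _)), Finset.sum_range_succ,
    Finset.sum_range_succ (fun l => ((n : ℂ[X]) + 1) * (C _ * _))]
  simp only [Nat.cast_zero, zero_mul, mul_zero, add_zero]
  rw [add_right_comm, ← Finset.sum_add_distrib]
  congr 1
  · refine Finset.sum_congr rfl fun l hl => ?_
    obtain ⟨k, rfl⟩ : ∃ k, n = l + k + 1 := ⟨n - l - 1, by have := Finset.mem_range.1 hl; omega⟩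
    have h1 := congrArg (Nat.cast (R := ℂ[X])) (Nat.add_one_mul_choose_eq (l + k + 1) l)
    have h2 := congrArg (Nat.cast (R := ℂ[X])) (Nat.choose_mul_succ_eq (l + k + 1) l)
    rw [show l + k + 1 - (l + 1) = k by omega, show l + k + 1 - l = k + 1 by omega,
      ← add_assoc (l + k + 1), Nat.choose_succ_succ (l + k + 1 + b), Nat.add_sub_cancel]
    rw [show l + k + 1 + 1 - l = k + 2 by omega] at h2
    simp only [map_natCast]
    push_cast [Nat.succ_eq_add_one] at h1 h2 ⊢
    linear_combination (X - 1) ^ (k + 1) * X ^ l *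
      (-((l + k + 1 + b).choose (k + 1) : ℂ[X]) * h2 - ((l + k + 1 + b).choose k : ℂ[X]) * h1)
  · simp

/-- The counterpart for `m = 0`, where the curl of `p(r²)(-y, x)` is `2 (t p)'` at `t = r²`. -/
theorem derivative_X_mul_one_sub_mul_sjacobi (n : ℕ) :
    derivative (X * ((1 - X) * sjacobi n 1 1)) = -((n : ℂ[X]) + 1) * sjacobi (n + 1) 0 0 := by
  have h : X * ((1 - X) * sjacobi n 1 1) = -∑ l ∈ Finset.range (n + 1),
      C (((n + 1).choose l * (n + 1).choose (n - l) : ℕ) : ℂ) *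
        ((X - 1) ^ (n - l + 1) * X ^ (l + 1)) := by
    rw [one_sub_mul_sjacobi, mul_neg, Finset.mul_sum, neg_inj]
    refine Finset.sum_congr rfl fun l _ => ?_
    generalize C ((_ : ℕ) : ℂ) = c
    ring
  -- The factor is split as `n + 1 = (n + 1 - l) + l`, to match the two halves of the product rule;
  -- the last term of the first sum and the first term of the second vanish.
  have h' : ((n : ℂ[X]) + 1) * sjacobi (n + 1) 0 0 =
      ∑ l ∈ Finset.range (n + 2), (((n + 1 - l : ℕ) : ℂ[X]) * ((n + 1).choose l : ℂ[X]) ^ 2 *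
          ((X - 1) ^ (n + 1 - l) * X ^ l)) +
        ∑ l ∈ Finset.range (n + 2), ((l : ℂ[X]) * ((n + 1).choose l : ℂ[X]) ^ 2 *
          ((X - 1) ^ (n + 1 - l) * X ^ l)) := by
    rw [sjacobi_eq_sum, Finset.mul_sum, ← Finset.sum_add_distrib]
    refine Finset.sum_congr rfl fun l hl => ?_
    have hl' : l ≤ n + 1 := by have := Finset.mem_range.1 hl; omega
    rw [add_zero, Nat.choose_symm hl', Nat.cast_sub hl', map_natCast]
    push_cast
    ring
  rw [h, derivative_neg, derivative_sum, neg_mul, neg_inj, h',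
    Finset.sum_range_succ _ (n + 1), Finset.sum_range_succ' _ (n + 1)]
  simp only [Nat.sub_self, Nat.cast_zero, zero_mul, add_zero]
  rw [← Finset.sum_add_distrib]
  refine Finset.sum_congr rfl fun l hl => ?_
  obtain ⟨k, rfl⟩ : ∃ k, n = l + k := ⟨n - l, by have := Finset.mem_range.1 hl; omega⟩
  have h1 := congrArg (Nat.cast (R := ℂ[X])) (Nat.choose_succ_right_eq (l + k + 1) l)
  rw [derivative_C_mul, derivative_sub_one_pow_mul_X_pow, map_natCast,
    show l + k - l = k by omega, show l + k + 1 - (l + 1) = k by omega,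
    show (l + k + 1).choose k = (l + k + 1).choose (l + 1) from
      Nat.choose_symm_of_eq_add (by omega), Nat.add_sub_cancel]
  rw [show l + k + 1 - l = k + 1 by omega] at h1 ⊢
  push_cast at h1 ⊢
  generalize ((l + k + 1).choose l : ℂ[X]) = p at *
  generalize ((l + k + 1).choose (l + 1) : ℂ[X]) = q at *
  linear_combination (X ^ l * p * (X - 1) ^ (k + 1) - X ^ (l + 1) * q * (X - 1) ^ k) * h1

/-- Every summand is a monic polynomial of degree `n` times a positive integer, so the leading
coefficients cannot cancel. -/
theorem degree_sjacobi (n a b : ℕ) : (sjacobi n a b).degree = n := by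
  have hm : ∀ l ∈ Finset.range (n + 1), ((X - 1 : ℂ[X]) ^ (n - l) * X ^ l).Monic ∧
      ((X - 1 : ℂ[X]) ^ (n - l) * X ^ l).natDegree = n := by
    intro l hl
    have h1 : (X - 1 : ℂ[X]).Monic := by simpa using monic_X_sub_C (1 : ℂ)
    have h2 : (X - 1 : ℂ[X]).natDegree = 1 := by simpa using natDegree_X_sub_C (1 : ℂ)
    refine ⟨(h1.pow _).mul (monic_X_pow _), ?_⟩
    rw [(h1.pow _).natDegree_mul (monic_X_pow _), h1.natDegree_pow, h2, natDegree_X_pow]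
    have := Finset.mem_range.1 hl
    omega
  refine degree_eq_of_le_of_coeff_ne_zero ?_ ?_
  · rw [sjacobi_eq_sum]
    refine (degree_sum_le _ _).trans (Finset.sup_le fun l hl => ?_)
    refine degree_le_of_natDegree_le ((natDegree_C_mul_le _ _).trans (hm l hl).2.le)
  · have h : (sjacobi n a b).coeff n =
        ((∑ l ∈ Finset.range (n + 1), (n + a).choose l * (n + b).choose (n - l) : ℕ) : ℂ) := by
      rw [sjacobi_eq_sum, finsetSum_coeff, Nat.cast_sum]
      refine Finset.sum_congr rfl fun l hl => ?_
      have h3 := (hm l hl).1.coeff_natDegree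
      rw [(hm l hl).2] at h3
      rw [coeff_C_mul, h3, mul_one]
    rw [h, Nat.cast_ne_zero]
    refine (Finset.sum_pos (fun l hl => ?_) ⟨0, by simp⟩).ne'
    have := Finset.mem_range.1 hl
    exact Nat.mul_pos (Nat.choose_pos (by omega)) (Nat.choose_pos (by omega))

end Jacobi

/-! ### Gradients and curls of the explicit fields. -/

section Plane

open MvPolynomial

theorem isgn_mul_self {m : ℤ} (hm : m ≠ 0) : isgn m * isgn m = -1 := by
  rcases lt_or_gt_of_ne hm with h | h
  · simp [isgn, Int.sign_eq_neg_one_of_neg h]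
  · simp [isgn, Int.sign_eq_one_of_pos h]

theorem C_isgn_mul_self {m : ℤ} (hm : m ≠ 0) : (C (isgn m) * C (isgn m) : Scal) = -1 := by
  rw [← C_mul, isgn_mul_self hm, C_neg, C_1]

theorem pderiv_rsq (i : Fin 2) : pderiv i rsq = 2 * X i := by
  fin_cases i <;> simp [rsq, pderiv_X]

theorem pderiv_aeval_rsq (i : Fin 2) (p : Polynomial ℂ) :
    pderiv i (Polynomial.aeval rsq p) =
      2 * X i * Polynomial.aeval rsq (Polynomial.derivative p) := by
  rw [Derivation.map_aeval, pderiv_rsq, smul_eq_mul, mul_comm]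

theorem wzernike_eq (m : ℤ) (j : ℕ) : wzernike m j =
    Polynomial.aeval rsq ((1 - Polynomial.X) * sjacobi j 1 m.natAbs) * harm m := by
  simp [wzernike, zernikeGen, mul_assoc]

theorem pderiv_harm (m : ℤ) (i : Fin 2) :
    pderiv i (harm m) = (m.natAbs : Scal) * vharm m i := by
  fin_cases i <;> simp [harm, vharm, pderiv_X]

theorem grad_apply (p : Scal) (i : Fin 2) : grad p i = pderiv i p := rfl

theorem curl_apply (f : Vec) : curl f = pderiv 0 (f 1) - pderiv 1 (f 0) := rfl

theorem curl_grad (p : Scal) : curl (grad p) = 0 := by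
  rw [curl_apply, grad_apply, grad_apply, sub_eq_zero]
  induction p using MvPolynomial.induction_on with
  | C a => simp
  | add p q hp hq => simp only [map_add, hp, hq]
  | mul_X p i hp => fin_cases i <;> simp [pderiv_X, hp] <;> ring

/-- The gradient of a radial multiple of a harmonic polynomial. -/
theorem grad_aeval_mul_harm (m : ℤ) (p : Polynomial ℂ) (i : Fin 2) :
    grad (Polynomial.aeval rsq p * harm m) i =
      2 * X i * Polynomial.aeval rsq (Polynomial.derivative p) * harm m +
        (m.natAbs : Scal) * Polynomial.aeval rsq p * vharm m i := by
  rw [grad_apply, Derivation.leibniz, pderiv_aeval_rsq, pderiv_harm, smul_eq_mul, smul_eq_mul]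
  ring

/-- `N` acts on `f` as `(f₁, f₂) ↦ (f₁, (1 - t) f₂)`. The hypothesis makes the result `(1 - t) f₂
(1, 1) + 2 t h (1, 0)`, where `(1, 1)` corresponds to `vharm m` and `t (1, 0)` to `(x, y) y_m`. This
is the shape of a gradient in `grad_aeval_mul_harm`. -/
theorem normalMat_mulVec_pmap {m : ℤ} (hm : m ≠ 0) (f : Fin 2 → Polynomial ℂ)
    (h : Polynomial ℂ) (hf : f 0 = f 1 + (2 * h - f 1) * Polynomial.X) (i : Fin 2) :
    normalMat.mulVec (pmap m f) i =
      2 * X i * Polynomial.aeval rsq h * harm m +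
        Polynomial.aeval rsq ((1 - Polynomial.X) * f 1) * vharm m i := by
  have hc : (Polynomial.C (1 / 2) : Polynomial ℂ) * 2 = 1 := by
    rw [show (2 : Polynomial ℂ) = Polynomial.C 2 from rfl, ← Polynomial.C_mul]; norm_num
  have hc' : (C (1 / 2) : Scal) * 2 = 1 := by
    rw [show (2 : Scal) = C 2 from rfl, ← C_mul]; norm_num
  -- By `hf` the difference is divisible by `X`, so `divX` discards no constant term.
  have hdiv : (Polynomial.C (1 / 2) * (f 0 - f 1)).divX =
      h - Polynomial.C (1 / 2) * f 1 := by
    have h1 : Polynomial.C (1 / 2) * (f 0 - f 1) =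
        (h - Polynomial.C (1 / 2) * f 1) * Polynomial.X := by
      rw [hf]; linear_combination h * Polynomial.X * hc
    have h2 := Polynomial.divX_mul_X_add (Polynomial.C (1 / 2) * (f 0 - f 1))
    rw [h1] at h2 ⊢
    simpa using h2
  have hadd : Polynomial.C (1 / 2) * (f 0 + f 1) =
      f 1 + (h - Polynomial.C (1 / 2) * f 1) * Polynomial.X := by
    rw [hf]; linear_combination (h * Polynomial.X + f 1) * hc
  have hpow : harm m =
      (X 0 + C (isgn m) * X 1) ^ (m.natAbs - 1) * (X 0 + C (isgn m) * X 1) := by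
    rw [harm, ← pow_succ]
    congr 1
    omega
  rw [pmap, hadd, hdiv, hpow]
  simp only [map_add, map_sub, map_mul, Polynomial.aeval_X, Polynomial.aeval_C, map_one,
    algebraMap_eq]
  generalize Polynomial.aeval rsq h = k
  generalize Polynomial.aeval rsq (f 1) = a
  fin_cases i <;>
  simp only [normalMat, sigmaMat, vharm, rsq, Matrix.mulVec, dotProduct, Fin.sum_univ_two,
    Matrix.of_apply, Matrix.cons_val_zero, Matrix.cons_val_one, Matrix.cons_val', Pi.add_apply,
    Pi.smul_apply, smul_eq_mul, Fin.zero_eta, Fin.mk_one, Matrix.cons_val_fin_one] <;>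
  generalize ((X 0 + C (isgn m) * X 1) ^ (m.natAbs - 1) : Scal) = L <;>
  generalize (C (isgn m) : Scal) = s <;>
  generalize (C (1 / 2) : Scal) = c at * <;>
  generalize (X 0 : Scal) = x <;>
  generalize (X 1 : Scal) = y
  · linear_combination (-L * a * x * (x + s * y)) * hc'
  · linear_combination (-L * a * y * (x + s * y)) * hc'

theorem normalMat_mulVec_pmap_vaux {m : ℤ} (hm : m ≠ 0) (n : ℕ) :
    normalMat.mulVec (pmap m (vaux n (m.natAbs - 1))) = grad (wzernike m n) := by
  obtain ⟨b, hb⟩ : ∃ b, m.natAbs = b + 1 := ⟨m.natAbs - 1, by omega⟩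
  funext i
  -- The chosen `h` is the derivative of `(1 - t) P_n^{(1,|m|)}(2t - 1)`, the radial factor of
  -- `w_{mn}`.
  rw [normalMat_mulVec_pmap hm _ (-((n : Polynomial ℂ) + 1) * sjacobi n 0 (b + 2)), wzernike_eq,
    grad_aeval_mul_harm, derivative_one_sub_mul_sjacobi, hb]
  · congr 2
    simp [vaux, Polynomial.smul_eq_C_mul]
    ring
  · have h2 : (Polynomial.C 2 : Polynomial ℂ) = 2 := rfl
    simp [hb, vaux, Polynomial.smul_eq_C_mul, h2]
    ring

theorem normalMat_mulVec_pmap_smul_one_sub {m : ℤ} (hm : m ≠ 0) (p : Polynomial ℂ) :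
    normalMat.mulVec (pmap m ![p * (1 - Polynomial.X), p]) =
      (Polynomial.aeval rsq ((1 - Polynomial.X) * p) : Scal) • vharm m := by
  funext i
  rw [normalMat_mulVec_pmap hm _ 0]
  · simp
  · simp; ring

/-- The field `vharm m` is curl-free by the Cauchy–Riemann relation `hL`, so only the radial factor
is differentiated. -/
theorem curl_aeval_smul_vharm {m : ℤ} (hm : m ≠ 0) (p : Polynomial ℂ) :
    curl ((Polynomial.aeval rsq p : Scal) • vharm m) =
      (2 * isgn m) • (Polynomial.aeval rsq (Polynomial.derivative p) * harm m) := by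
  have hpow : harm m =
      (X 0 + C (isgn m) * X 1) ^ (m.natAbs - 1) * (X 0 + C (isgn m) * X 1) := by
    rw [harm, ← pow_succ]
    congr 1
    omega
  have hs := C_isgn_mul_self hm
  have hL : pderiv 1 ((X 0 + C (isgn m) * X 1) ^ (m.natAbs - 1) : Scal) =
      C (isgn m) * pderiv 0 ((X 0 + C (isgn m) * X 1) ^ (m.natAbs - 1) : Scal) := by
    simp [pderiv_X]
    ring
  rw [hpow, curl_apply, vharm]
  simp only [Pi.smul_apply, smul_eq_mul, Derivation.leibniz, pderiv_aeval_rsq, hL,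
    Matrix.cons_val_zero, Matrix.cons_val_one, pderiv_C, smul_eq_C_mul,
    Derivation.map_one_eq_zero, C_mul, map_ofNat]
  linear_combination (-2 * X 1 * Polynomial.aeval rsq (Polynomial.derivative p) *
    ((X 0 + C (isgn m) * X 1) ^ (m.natAbs - 1) : Scal)) * hs

theorem pmap_add (m : ℤ) (f g : Fin 2 → Polynomial ℂ) : pmap m (f + g) = pmap m f + pmap m g := by
  have h : Polynomial.C (1 / 2) * ((f + g) 0 - (f + g) 1) =
      Polynomial.C (1 / 2) * (f 0 - f 1) + Polynomial.C (1 / 2) * (g 0 - g 1) := by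
    simp only [Pi.add_apply]; ring
  rw [pmap, h, Polynomial.divX_add]
  simp only [pmap, Pi.add_apply, map_add, map_mul]
  module

theorem pmap_smul (m : ℤ) (c : ℂ) (f : Fin 2 → Polynomial ℂ) : pmap m (c • f) = c • pmap m f := by
  have h : Polynomial.C (1 / 2) * ((c • f) 0 - (c • f) 1) =
      Polynomial.C c * (Polynomial.C (1 / 2) * (f 0 - f 1)) := by
    simp only [Pi.smul_apply, Polynomial.smul_eq_C_mul]; ring
  rw [pmap, h, Polynomial.divX_C_mul, pmap, smul_add, ← smul_assoc, ← smul_assoc]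
  simp only [Pi.smul_apply, ← smul_add, map_mul, map_smul, Polynomial.aeval_C, mul_smul_comm,
    algebraMap_eq, ← smul_eq_C_mul]

/-- The operator `f ↦ N 𝒫_m f` as a linear map. -/
def normalPmap (m : ℤ) : (Fin 2 → Polynomial ℂ) →ₗ[ℂ] Vec where
  toFun f := normalMat.mulVec (pmap m f)
  map_add' f g := by rw [pmap_add, Matrix.mulVec_add]
  map_smul' c f := by rw [pmap_smul, Matrix.mulVec_smul, RingHom.id_apply]

theorem rconst_ne_zero (n b : ℕ) : rconst n b ≠ 0 := by
  have h : rconst n b =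
      ((10 * n ^ 2 + n * (13 * b + 19) + 4 * (b + 1) * (b + 2) : ℕ) : ℂ) := by
    simp [rconst]
  rw [h, Nat.cast_ne_zero]
  positivity

/-- The coefficient of `z_{mj}` in `curl n_{mj}^-` for `m ≠ 0`. -/
def curlCoeff (m : ℤ) (j : ℕ) : ℂ :=
  -4 * isgn m * ((2 * j + m.natAbs) * (2 * j + m.natAbs + 1) * (2 * j + m.natAbs + 2)) /
    rconst j (m.natAbs - 1)

/-- The `vaux` part of `q1` yields a gradient and drops out under the curl. -/
theorem curl_n1 {m : ℤ} (hm : m ≠ 0) (j : ℕ) :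
    (2 : ℂ) • curl (n1 m j) = curlCoeff m j • zernike m j := by
  obtain ⟨b, hb⟩ : ∃ b, m.natAbs = b + 1 := ⟨m.natAbs - 1, by omega⟩
  have h0 : n1 m j = normalPmap m (q1 j (m.natAbs - 1)) := by rw [n1, vN1, if_neg hm]; rfl
  have h1 : normalPmap m (vaux j (m.natAbs - 1)) = grad (wzernike m j) :=
    normalMat_mulVec_pmap_vaux hm j
  have h2 (p : Polynomial ℂ) := normalMat_mulVec_pmap_smul_one_sub hm p
  have h3 : curl (normalPmap m ![sjacobi j 1 (m.natAbs - 1) * (1 - Polynomial.X),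
      sjacobi j 1 (m.natAbs - 1)]) = (-2 * isgn m * (j + 1)) • zernike m j := by
    rw [show normalPmap m _ = _ from h2 _, curl_aeval_smul_vharm hm,
      derivative_one_sub_mul_sjacobi, zernike, zernikeGen, hb]
    simp only [smul_eq_C_mul, map_mul, map_neg, map_add, map_natCast, map_one, map_ofNat,
      Nat.add_sub_cancel]
    ring
  rw [h0, q1, map_smul, map_sub, map_smul, map_smul, map_smul, map_sub, map_smul, map_smul, h1,
    curl_grad, h3]
  simp only [smul_zero, sub_zero, smul_smul, curlCoeff]
  congr 1
  have := rconst_ne_zero j b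
  have := Nat.cast_add_one_ne_zero (R := ℂ) j
  simp only [hb, Nat.add_sub_cancel]
  push_cast
  field_simp
  ring

/-- For `m ≠ 0` the definition of `q2` makes `q1 + q2` a multiple of `vaux`; for `m = 0` the radial
field `(x, y)` is fixed by `N`. -/
theorem nPlus_succ (m : ℤ) (j : ℕ) :
    nPlus m (j + 1) = (-(1 / ((j : ℂ) + 1))) • grad (wzernike m j) := by
  rcases eq_or_ne m 0 with rfl | hm
  · have := Nat.cast_add_one_ne_zero (R := ℂ) j
    have h : (2 : ℂ) • n1 0 (j + 1) = (2 : ℂ) • Polynomial.aeval rsq (sjacobi j 0 1) •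
        (![X 0, X 1] : Vec) := by
      rw [n1, vN1, if_pos rfl, Matrix.mulVec_smul, Nat.add_sub_cancel]
      congr 2
      funext i
      fin_cases i <;> simp [normalMat, Matrix.mulVec, dotProduct, Fin.sum_univ_two] <;> ring
    rw [nPlus, if_pos rfl, h, wzernike_eq]
    funext i
    rw [Pi.smul_apply (-_), grad_aeval_mul_harm, Int.natAbs_zero, derivative_one_sub_mul_sjacobi]
    have h1 : (C (1 / ((j : ℂ) + 1)) : Scal) * ((j : Scal) + 1) = 1 := by
      rw [← map_natCast C, ← C_1, ← C_add, ← C_mul, one_div_mul_cancel this]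
    fin_cases i <;> simp [harm, smul_eq_C_mul, -one_div]
    · linear_combination (-2 * X 0 * Polynomial.aeval rsq (sjacobi j 0 1)) * h1 +
        X 0 * Polynomial.aeval rsq (sjacobi j 0 1) * (map_ofNat C 2 : (C 2 : Scal) = 2)
    · linear_combination (-2 * X 1 * Polynomial.aeval rsq (sjacobi j 0 1)) * h1 +
        X 1 * Polynomial.aeval rsq (sjacobi j 0 1) * (map_ofNat C 2 : (C 2 : Scal) = 2)
  · have h : n1 m (j + 1) + n2 m (j + 1) =
        normalPmap m (q1 (j + 1) (m.natAbs - 1) + q2 (j + 1) (m.natAbs - 1)) := by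
      rw [map_add, n1, vN1, n2, vN2, if_neg hm, if_neg hm]; rfl
    rw [nPlus, if_neg hm, h, q2, add_sub_cancel, map_neg, map_smul, neg_smul]
    exact congrArg (fun x => -((1 / ((j : ℂ) + 1)) • x)) (normalMat_mulVec_pmap_vaux hm j)

theorem curl_nPlus_succ (m : ℤ) (j : ℕ) : curl (nPlus m (j + 1)) = 0 := by
  rw [nPlus_succ, map_smul, curl_grad, smul_zero]

theorem curl_nMinus_zero_succ (j : ℕ) :
    curl (nMinus 0 (j + 1)) = (-4 * ((j : ℂ) + 1)) • zernike 0 (j + 1) := by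
  -- The angular direction is an eigenvector of `N`.
  have h : normalMat.mulVec ![-X 1, X 0] = ((1 - rsq : Scal)) • (![-X 1, X 0] : Vec) := by
    funext i
    fin_cases i <;> simp [normalMat, Matrix.mulVec, dotProduct, Fin.sum_univ_two, rsq] <;> ring
  have h' : Polynomial.aeval rsq (sjacobi j 1 1) • (1 - rsq : Scal) • (![-X 1, X 0] : Vec) =
      Polynomial.aeval rsq ((1 - Polynomial.X) * sjacobi j 1 1) • (![-X 1, X 0] : Vec) := by
    rw [smul_smul, map_mul, mul_comm]
    simp
  have hd := congrArg (Polynomial.aeval rsq) (derivative_X_mul_one_sub_mul_sjacobi j)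
  rw [nMinus, if_pos rfl, n2, vN2, if_pos rfl, Matrix.mulVec_smul, Nat.add_sub_cancel, h, h',
    map_smul, curl_apply]
  simp only [Pi.smul_apply, smul_eq_mul, Derivation.leibniz, pderiv_aeval_rsq, smul_eq_C_mul,
    Matrix.cons_val_zero, Matrix.cons_val_one, pderiv_X_self, map_neg, zernike, zernikeGen]
  generalize (1 - Polynomial.X) * sjacobi j 1 1 = p at *
  simp only [Polynomial.derivative_mul, Polynomial.derivative_X, map_add, map_mul, map_neg,
    map_natCast, map_one, Polynomial.aeval_X, one_mul] at hd
  have h2 : (C 2 : Scal) = 2 := map_ofNat C 2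
  have h4 : (C 4 : Scal) = 4 := map_ofNat C 4
  simp [harm, rsq, h2, h4] at hd ⊢
  linear_combination 4 * hd

/-- Since `n1 + n2` is curl-free for positive index, `n1 - n2` has twice the curl of `n1`; at `j =
0` the factor two is in the definition. -/
theorem curl_nMinus {m : ℤ} (hm : m ≠ 0) (j : ℕ) :
    curl (nMinus m j) = curlCoeff m j • zernike m j := by
  rw [← curl_n1 hm]
  cases j with
  | zero => simp [nMinus, hm]
  | succ j =>
    have h := curl_nPlus_succ m j
    rw [nPlus, if_neg hm, map_add] at h
    simp only [nMinus, hm, if_false, Nat.succ_ne_zero, map_sub, eq_neg_of_add_eq_zero_right h]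
    module

theorem exists_curl_nMinus (p : ℤ × ℕ) (hp : p ≠ (0, 0)) :
    ∃ c : ℂˣ, curl (nMinus p.1 p.2) = c • zernike p.1 p.2 := by
  obtain ⟨m, j⟩ := p
  rcases eq_or_ne m 0 with rfl | hm
  · obtain ⟨j, rfl⟩ := Nat.exists_eq_succ_of_ne_zero (n := j) (by rintro rfl; exact hp rfl)
    have : -4 * ((j : ℂ) + 1) ≠ 0 := mul_ne_zero (by norm_num) (Nat.cast_add_one_ne_zero j)
    exact ⟨Units.mk0 _ this, curl_nMinus_zero_succ j⟩
  · refine ⟨Units.mk0 (curlCoeff m j) ?_, curl_nMinus hm j⟩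
    obtain ⟨b, hb⟩ : ∃ b, m.natAbs = b + 1 := ⟨m.natAbs - 1, by omega⟩
    have h1 : isgn m ≠ 0 := fun h => by simpa [h] using isgn_mul_self hm
    have h2 : ((2 * (j : ℂ) + m.natAbs) * (2 * j + m.natAbs + 1) * (2 * j + m.natAbs + 2)) ≠ 0 := by
      rw [hb]
      norm_cast
    exact div_ne_zero (mul_ne_zero (mul_ne_zero (by norm_num) h1) h2) (rconst_ne_zero _ _)

end Plane

/-! ### Mode decomposition, and bases of the scalar spaces. -/

section Bases

open MvPolynomial Module

/-- The substitution `x ↦ x + i y`, `y ↦ x - i y`. -/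
def complexCoord : Scal ≃ₐ[ℂ] Scal :=
  AlgEquiv.ofAlgHom
    (aeval ![X 0 + C Complex.I * X 1, X 0 - C Complex.I * X 1])
    (aeval ![C (1 / 2) * (X 0 + X 1), C (-Complex.I / 2) * (X 0 - X 1)])
    (by
      have h : (C (1 / 2) : Scal) * 2 = 1 := by
        rw [show (2 : Scal) = C 2 from (map_ofNat C 2).symm, ← C_mul]; norm_num
      have h' : (C (-Complex.I / 2) * C Complex.I : Scal) = C (1 / 2) := by
        rw [← C_mul, div_mul_eq_mul_div, neg_mul, Complex.I_mul_I, neg_neg]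
      ext i : 1
      fin_cases i <;> simp [algHom_C, algebraMap_eq, -one_div]
      · linear_combination X 0 * h
      · linear_combination 2 * X 1 * h' + X 1 * h)
    (by
      have h : (C (1 / 2) : Scal) * 2 = 1 := by
        rw [show (2 : Scal) = C 2 from (map_ofNat C 2).symm, ← C_mul]; norm_num
      have h' : (C (-Complex.I / 2) * C Complex.I : Scal) = C (1 / 2) := by
        rw [← C_mul, div_mul_eq_mul_div, neg_mul, Complex.I_mul_I, neg_neg]
      ext i : 1
      fin_cases i <;> simp [algHom_C, algebraMap_eq, -one_div]
      · linear_combination (X 0 - X 1) * h' + X 0 * h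
      · linear_combination (X 1 - X 0) * h' + X 1 * h)

/-- The exponents `(a, b)` of `(x + iy)^a (x - iy)^b = r^(2k) y_m` in terms of `m` and `k`. -/
def modeIndex : (Σ _ : ℤ, ℕ) ≃ (Fin 2 →₀ ℕ) :=
  Equiv.trans
    { toFun := fun p => (p.2 + p.1.toNat, p.2 + (-p.1).toNat)
      invFun := fun q => ⟨(q.1 : ℤ) - q.2, min q.1 q.2⟩
      left_inv := by
        rintro ⟨m, k⟩
        refine Sigma.ext ?_ (heq_of_eq ?_) <;> simp only <;> omega
      right_inv := by
        rintro ⟨a, b⟩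
        refine Prod.ext ?_ ?_ <;> simp only <;> omega }
    ((finTwoArrowEquiv ℕ).symm.trans Finsupp.equivFunOnFinite.symm)

/-- The basis `r^(2k) y_m` of the space of polynomials. -/
def modeBasis : Basis (Σ _ : ℤ, ℕ) ℂ Scal :=
  ((basisMonomials (Fin 2) ℂ).map complexCoord.toLinearEquiv).reindex modeIndex.symm

theorem rsq_eq : rsq = (X 0 + C Complex.I * X 1) * (X 0 - C Complex.I * X 1) := by
  have h : (C Complex.I * C Complex.I : Scal) = -1 := by
    rw [← C_mul, Complex.I_mul_I, C_neg, C_1]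
  rw [rsq]
  linear_combination X 1 ^ 2 * h

/-- At least one of the two exponents is zero. With `rsq_eq`, this makes each `r^(2k) y_m` a
monomial in `x + iy` and `x - iy`. -/
theorem harm_eq (m : ℤ) : harm m =
    (X 0 + C Complex.I * X 1) ^ m.toNat * (X 0 - C Complex.I * X 1) ^ (-m).toNat := by
  rcases le_total 0 m with h | h
  · obtain ⟨n, rfl⟩ := Int.eq_ofNat_of_zero_le h
    rcases Nat.eq_zero_or_pos n with rfl | hn
    · simp [harm]
    · simp [harm, isgn, Int.sign_eq_one_of_pos (Int.natCast_pos.2 hn)]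
  · obtain ⟨n, hn⟩ := Int.eq_ofNat_of_zero_le (neg_nonneg.2 h)
    obtain rfl : m = -n := by omega
    rcases Nat.eq_zero_or_pos n with rfl | hn
    · simp [harm]
    · simp [harm, isgn, Int.sign_eq_one_of_pos (Int.natCast_pos.2 hn), sub_eq_add_neg]

theorem modeBasis_apply (m : ℤ) (k : ℕ) : modeBasis ⟨m, k⟩ = rsq ^ k * harm m := by
  rw [modeBasis, Basis.reindex_apply, Basis.map_apply, coe_basisMonomials, Equiv.symm_symm]
  have h : monomial (modeIndex ⟨m, k⟩) (1 : ℂ) =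
      X 0 ^ (k + m.toNat) * X 1 ^ (k + (-m).toNat) := by
    rw [monomial_eq]
    simp [Finsupp.prod_fintype, Fin.prod_univ_two, modeIndex]
  simp only [h, rsq_eq, harm_eq]
  simp [complexCoord, mul_pow]
  ring

/-- Decomposition of a polynomial into its modes `p_m(r²) y_m`. -/
def modeEquiv : (ℤ →₀ Polynomial ℂ) ≃ₗ[ℂ] Scal :=
  (Finsupp.basis fun _ => Polynomial.basisMonomials ℂ).equiv modeBasis (Equiv.refl _)

theorem modeEquiv_single (m : ℤ) (p : Polynomial ℂ) :
    modeEquiv (Finsupp.single m p) = Polynomial.aeval rsq p * harm m := by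
  have h : modeEquiv.toLinearMap ∘ₗ Finsupp.lsingle m =
      LinearMap.mulRight ℂ (harm m) ∘ₗ (Polynomial.aeval rsq).toLinearMap := by
    refine (Polynomial.basisMonomials ℂ).ext fun k => ?_
    have := (Finsupp.basis fun _ : ℤ => Polynomial.basisMonomials ℂ).equiv_apply ⟨m, k⟩ modeBasis
      (Equiv.refl _)
    rw [Finsupp.coe_basis, Equiv.refl_apply, modeBasis_apply] at this
    simpa [modeEquiv] using this
  exact LinearMap.congr_fun h p

/-- The shifted Jacobi polynomials, one for each degree. -/
def jacobiSequence (a b : ℕ) : Polynomial.Sequence ℂ where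
  elems' n := sjacobi n a b
  degree_eq' n := degree_sjacobi n a b

/-- The generalised Zernike polynomials form a basis. -/
def zernikeGenBasis (a : ℕ) : Basis (ℤ × ℕ) ℂ Scal :=
  -- In every mode, a sequence with one polynomial of each degree is a basis over a field.
  ((Finsupp.basis fun m : ℤ => (jacobiSequence a m.natAbs).basis fun i =>
    (Polynomial.leadingCoeff_ne_zero.2 ((jacobiSequence a m.natAbs).ne_zero i)).isUnit).map
      modeEquiv).reindex (Equiv.sigmaEquivProd ℤ ℕ)

theorem zernikeGenBasis_apply (a : ℕ) (p : ℤ × ℕ) :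
    zernikeGenBasis a p = zernikeGen a p.1 p.2 := by
  rw [zernikeGenBasis, Basis.reindex_apply, Basis.map_apply, Finsupp.coe_basis]
  simp only [Equiv.sigmaEquivProd_symm_apply, modeEquiv_single, Polynomial.Sequence.basis_eq_self]
  rfl

theorem injective_zpow_circle :
    Function.Injective fun m : ℤ => Circle.coeHom.comp (zpowGroupHom m : Circle →* Circle) := by
  intro m n h
  by_contra hmn
  -- The `(m - n)`-th power of this point is `-1`, which separates the two characters.
  have h1 := DFunLike.congr_fun h (Circle.exp (Real.pi / ((m : ℝ) - n)))
  have h0 : ((m : ℝ) - n) ≠ 0 := sub_ne_zero.2 (by exact_mod_cast hmn)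
  have h2 : Circle.exp (Real.pi / ((m : ℝ) - n)) ^ (m - n) = 1 := by
    rw [zpow_sub, mul_inv_eq_one]
    exact Circle.ext h1
  have h3 := congrArg (Subtype.val) h2
  rw [Circle.coe_zpow, Circle.coe_exp, ← Complex.exp_int_mul] at h3
  have h4 : (((m - n : ℤ) : ℂ)) * (((Real.pi / ((m : ℝ) - n) : ℝ) : ℂ) * Complex.I) =
      Real.pi * Complex.I := by
    have : ((m : ℂ) - n) ≠ 0 := by exact_mod_cast h0
    push_cast
    field_simp
  rw [h4, Complex.exp_pi_mul_I] at h3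
  norm_num at h3

/-- On the circle the mode `p_m(r²) y_m` restricts to `p_m(1) z^m`. Distinct characters are linearly
independent, so every `p_m` has the root `1`. -/
theorem one_sub_rsq_dvd_of_mem_vanishing {p : Scal} (hp : p ∈ vanishing) : 1 - rsq ∣ p := by
  obtain ⟨f, rfl⟩ := modeEquiv.surjective p
  have hsum : modeEquiv f = ∑ m ∈ f.support, Polynomial.aeval rsq (f m) * harm m := by
    conv_lhs => rw [← f.sum_single, Finsupp.sum, map_sum]
    simp only [modeEquiv_single]
  have hLI := (linearIndependent_monoidHom Circle ℂ).comp _ injective_zpow_circle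
  have heval (g : Polynomial ℂ) (m : ℤ) (z : Circle) :
      eval ![((z : ℂ).re : ℂ), ((z : ℂ).im : ℂ)] (Polynomial.aeval rsq g * harm m) =
        g.eval 1 * (z : ℂ) ^ m := by
    have h1 : eval ![((z : ℂ).re : ℂ), ((z : ℂ).im : ℂ)] rsq = 1 := by
      have := Circle.normSq_coe z
      rw [Complex.normSq_apply] at this
      simp only [rsq, map_add, map_pow, eval_X, Matrix.cons_val_zero, Matrix.cons_val_one]
      norm_cast
      linarith
    have h2 : eval ![((z : ℂ).re : ℂ), ((z : ℂ).im : ℂ)] (Polynomial.aeval rsq g) = g.eval 1 := by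
      rw [Polynomial.aeval_def, Polynomial.hom_eval₂, h1, algebraMap_eq,
        show (eval _).comp C = RingHom.id ℂ from RingHom.ext fun a => eval_C a, Polynomial.eval₂_id]
    rw [map_mul, h2]
    congr 1
    simp only [harm, map_pow, map_add, map_mul, eval_X, eval_C, Matrix.cons_val_zero,
      Matrix.cons_val_one, isgn]
    rcases lt_trichotomy m 0 with h | rfl | h
    · have h3 : ((z : ℂ).re : ℂ) + Complex.I * ((m.sign : ℤ) : ℂ) * ((z : ℂ).im : ℂ) =
          (z : ℂ)⁻¹ := by
        rw [← Circle.coe_inv, Circle.coe_inv_eq_conj, Int.sign_eq_neg_one_of_neg h]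
        apply Complex.ext <;> simp
      rw [h3, inv_pow, ← zpow_natCast, ← zpow_neg]
      congr 1
      omega
    · simp
    · have h3 : ((z : ℂ).re : ℂ) + Complex.I * ((m.sign : ℤ) : ℂ) * ((z : ℂ).im : ℂ) = z := by
        rw [Int.sign_eq_one_of_pos h]
        apply Complex.ext <;> simp
      rw [h3, ← zpow_natCast]
      congr 1
      omega
  have hzero : ∀ m ∈ f.support, (f m).eval 1 = 0 := by
    refine linearIndependent_iff'.1 hLI f.support _ ?_
    funext z
    have h := hp (z : ℂ).re (z : ℂ).im (by
      have := Circle.normSq_coe z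
      rw [Complex.normSq_apply] at this
      linarith)
    rw [hsum, map_sum] at h
    have hχ (m : ℤ) : Circle.coeHom.comp (zpowGroupHom m : Circle →* Circle) z = (z : ℂ) ^ m :=
      Circle.coe_zpow z m
    simp only [heval] at h
    simpa [hχ, -MonoidHom.coe_comp] using h
  rw [hsum]
  refine Finset.dvd_sum fun m hm => Dvd.dvd.mul_right ?_ _
  obtain ⟨q, hq⟩ := Polynomial.dvd_iff_isRoot.2 (hzero m hm)
  rw [hq]
  exact ⟨-Polynomial.aeval rsq q, by simp; ring⟩

theorem one_sub_rsq_ne_zero : (1 - rsq : Scal) ≠ 0 := by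
  intro h
  have := congrArg (eval 0) h
  simp [rsq] at this

theorem linearIndependent_wzernike :
    LinearIndependent ℂ (fun p : ℤ × ℕ => wzernike p.1 p.2) := by
  have h := (zernikeGenBasis 1).linearIndependent.map' (LinearMap.mulLeft ℂ (1 - rsq))
    (LinearMap.ker_eq_bot.2 (mul_right_injective₀ one_sub_rsq_ne_zero))
  have h' : LinearMap.mulLeft ℂ (1 - rsq) ∘ zernikeGenBasis 1 =
      fun p : ℤ × ℕ => wzernike p.1 p.2 := by
    funext p
    simp [zernikeGenBasis_apply, wzernike]
  rwa [h'] at h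

theorem span_wzernike :
    Submodule.span ℂ (Set.range fun p : ℤ × ℕ => wzernike p.1 p.2) = vanishing := by
  have h : (Set.range fun p : ℤ × ℕ => wzernike p.1 p.2) =
      LinearMap.mulLeft ℂ (1 - rsq) '' Set.range (zernikeGenBasis 1) := by
    rw [← Set.range_comp]
    congr 1
    funext p
    simp [zernikeGenBasis_apply, wzernike]
  rw [h, ← Submodule.map_span, (zernikeGenBasis 1).span_eq]
  refine le_antisymm ?_ fun p hp => ?_
  · rintro _ ⟨q, -, rfl⟩ x y hxy
    have : (x : ℂ) ^ 2 + (y : ℂ) ^ 2 = 1 := by exact_mod_cast hxy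
    simp [rsq, this]
  · obtain ⟨q, rfl⟩ := one_sub_rsq_dvd_of_mem_vanishing hp
    exact ⟨q, trivial, rfl⟩

theorem linearIndependent_zernike : LinearIndependent ℂ (fun p : ℤ × ℕ => zernike p.1 p.2) := by
  have h : ⇑(zernikeGenBasis 0) = fun p : ℤ × ℕ => zernike p.1 p.2 :=
    funext (zernikeGenBasis_apply 0)
  exact h ▸ (zernikeGenBasis 0).linearIndependent

theorem span_zernike : Submodule.span ℂ (Set.range fun p : ℤ × ℕ => zernike p.1 p.2) = ⊤ := by
  rw [← (zernikeGenBasis 0).span_eq]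
  congr 2
  funext p
  exact (zernikeGenBasis_apply 0 p).symm

end Bases

/-! ### Poincaré lemma and potentials of normal fields. -/

section Exactness

open MvPolynomial Module

/-- The antiderivative of a polynomial in one of its variables. -/
def antideriv (i : Fin 2) : Scal →ₗ[ℂ] Scal :=
  (basisMonomials (Fin 2) ℂ).constr ℂ fun s =>
    monomial (s + Finsupp.single i 1) (1 / ((s i : ℂ) + 1))

theorem antideriv_monomial (i : Fin 2) (s : Fin 2 →₀ ℕ) (a : ℂ) :
    antideriv i (monomial s a) = monomial (s + Finsupp.single i 1) (a / ((s i : ℂ) + 1)) := by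
  have h : monomial s a = a • basisMonomials (Fin 2) ℂ s := by simp [smul_monomial]
  rw [h, map_smul, antideriv, Basis.constr_basis, smul_monomial, smul_eq_mul, mul_one_div]

theorem pderiv_antideriv (i : Fin 2) (p : Scal) : pderiv i (antideriv i p) = p := by
  induction p using MvPolynomial.induction_on' with
  | monomial s a =>
    have := Nat.cast_add_one_ne_zero (R := ℂ) (s i)
    rw [antideriv_monomial, pderiv_monomial, add_tsub_cancel_right]
    simp [div_mul_cancel₀ _ this]
  | add p q hp hq => rw [map_add, map_add, hp, hq]

theorem pderiv_antideriv_comm {i j : Fin 2} (hij : i ≠ j) (p : Scal) :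
    pderiv j (antideriv i p) = antideriv i (pderiv j p) := by
  induction p using MvPolynomial.induction_on' with
  | monomial s a =>
    have h : s + Finsupp.single i 1 - Finsupp.single j 1 =
        s - Finsupp.single j 1 + Finsupp.single i 1 := by
      ext k
      by_cases hk : i = k
      · subst hk; simp [hij.symm]
      · simp [Finsupp.single_apply, hk]
    rw [antideriv_monomial, pderiv_monomial, pderiv_monomial, antideriv_monomial, h]
    simp [hij, hij.symm, div_mul_eq_mul_div]
  | add p q hp hq => simp only [map_add, hp, hq]

/-- The Poincaré lemma for polynomials. -/
theorem exists_grad_eq_of_curl_eq_zero {f : Vec} (hf : curl f = 0) : ∃ p, grad p = f := by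
  have h : pderiv 0 (f 1) = pderiv 1 (f 0) := sub_eq_zero.1 hf
  -- What is still missing in the second component does not depend on `x`, so integrating it in `y`
  -- leaves the first component intact.
  have h0 : pderiv 0 (f 1 - pderiv 1 (antideriv 0 (f 0))) = 0 := by
    rw [pderiv_antideriv_comm (by decide), map_sub, pderiv_antideriv, h, sub_self]
  refine ⟨antideriv 0 (f 0) + antideriv 1 (f 1 - pderiv 1 (antideriv 0 (f 0))), ?_⟩
  funext i
  rw [grad_apply, map_add]
  fin_cases i
  · simp only [Fin.zero_eta]
    rw [pderiv_antideriv, pderiv_antideriv_comm (i := 1) (by decide), h0, map_zero, add_zero]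
  · simp only [Fin.mk_one]
    rw [pderiv_antideriv, add_sub_cancel]

theorem eq_C_of_grad_eq_zero {p : Scal} (hp : grad p = 0) : p = C (coeff 0 p) := by
  ext s
  rw [coeff_C]
  split_ifs with hs
  · rw [hs]
  · obtain ⟨i, hi⟩ : ∃ i, s i ≠ 0 := by
      by_contra! h
      exact hs (Finsupp.ext fun i => (h i).symm)
    have hsi : s - Finsupp.single i 1 + Finsupp.single i 1 = s :=
      tsub_add_cancel_of_le (Finsupp.single_le_iff.2 (Nat.one_le_iff_ne_zero.2 hi))
    have h := congrArg (coeff (s - Finsupp.single i 1)) (congrFun hp i)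
    rw [grad_apply, coeff_pderiv, hsi, Pi.zero_apply, coeff_zero] at h
    exact (mul_eq_zero.1 h).resolve_right (Nat.cast_add_one_ne_zero _)

theorem hasDerivAt_eval_circle (p : Scal) (θ : ℝ) :
    HasDerivAt (fun θ : ℝ => eval ![(Real.cos θ : ℂ), (Real.sin θ : ℂ)] p)
      (-(Real.sin θ : ℂ) * eval ![(Real.cos θ : ℂ), (Real.sin θ : ℂ)] (grad p 0) +
        (Real.cos θ : ℂ) * eval ![(Real.cos θ : ℂ), (Real.sin θ : ℂ)] (grad p 1)) θ := by
  simp only [grad_apply]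
  induction p using MvPolynomial.induction_on with
  | C a => simpa using hasDerivAt_const θ a
  | add p q hp hq =>
    simp only [map_add]
    exact (hp.add hq).congr_deriv (by ring)
  | mul_X p i hp =>
    have hx : HasDerivAt (fun θ : ℝ => ![(Real.cos θ : ℂ), (Real.sin θ : ℂ)] i)
        (![-(Real.sin θ : ℂ), (Real.cos θ : ℂ)] i) θ := by
      fin_cases i
      · exact_mod_cast (Real.hasDerivAt_cos θ).ofReal_comp
      · exact (Real.hasDerivAt_sin θ).ofReal_comp
    simp only [map_mul, eval_X]
    refine (hp.mul hx).congr_deriv ?_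
    fin_cases i <;> simp [pderiv_X] <;> ring

/-- Constants that are the tangential derivative of a polynomial along the circle vanish. -/
theorem eq_zero_of_tangential_eq {p : Scal} {c : ℂ}
    (h : ∀ x y : ℝ, x ^ 2 + y ^ 2 = 1 → -(y : ℂ) * eval ![(x : ℂ), (y : ℂ)] (grad p 0) +
      (x : ℂ) * eval ![(x : ℂ), (y : ℂ)] (grad p 1) = c) :
    c = 0 ∧ ∀ x y : ℝ, x ^ 2 + y ^ 2 = 1 →
      eval ![(x : ℂ), (y : ℂ)] p = eval ![1, 0] p := by
  set g : ℝ → ℂ := fun θ => eval ![(Real.cos θ : ℂ), (Real.sin θ : ℂ)] p with hg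
  have hd (θ : ℝ) : HasDerivAt g c θ :=
    (hasDerivAt_eval_circle p θ).congr_deriv (h _ _ (Real.cos_sq_add_sin_sq θ))
  -- Along the circle `p` has constant derivative `c` in the angle; being periodic, it forces `c =
  -- 0`.
  have hconst : ∀ θ, g θ - θ * c = g 0 := by
    intro θ
    have hd' (θ : ℝ) : HasDerivAt (fun θ : ℝ => g θ - θ * c) 0 θ :=
      ((hd θ).sub ((hasDerivAt_id θ).ofReal_comp.mul_const c)).congr_deriv (by simp)
    have := is_const_of_deriv_eq_zero (fun θ => (hd' θ).differentiableAt)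
      (fun θ => (hd' θ).deriv) θ 0
    simpa using this
  have hc : c = 0 := by
    have h1 := hconst (2 * Real.pi)
    have h2 : g (2 * Real.pi) = g 0 := by simp [hg]
    rw [h2, sub_eq_self, mul_eq_zero] at h1
    exact h1.resolve_left (by exact_mod_cast Real.two_pi_pos.ne')
  refine ⟨hc, fun x y hxy => ?_⟩
  obtain ⟨θ, hθ⟩ : ∃ θ : ℝ, x = Real.cos θ ∧ y = Real.sin θ := by
    have hn : ‖(⟨x, y⟩ : ℂ)‖ = 1 := by
      rw [Complex.norm_def, Complex.normSq_apply, Real.sqrt_eq_one]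
      simpa [sq] using hxy
    refine ⟨Complex.arg ⟨x, y⟩, ?_, ?_⟩
    · have := Complex.norm_mul_cos_arg ⟨x, y⟩
      rw [hn, one_mul] at this
      exact this.symm
    · have := Complex.norm_mul_sin_arg ⟨x, y⟩
      rw [hn, one_mul] at this
      exact this.symm
  have h1 := hconst θ
  rw [hc, mul_zero, sub_zero] at h1
  rw [hθ.1, hθ.2]
  simpa [hg] using h1

theorem grad_injOn_vanishing {p : Scal} (hp : p ∈ vanishing) (h : grad p = 0) : p = 0 := by
  have h1 := eq_C_of_grad_eq_zero h
  have h2 := hp 1 0 (by norm_num)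
  rw [h1, eval_C] at h2
  rw [h1, h2, C_0]

theorem disjoint_vanishing_ker_grad : Disjoint vanishing (LinearMap.ker grad) :=
  Submodule.disjoint_def.2 fun _ hp h => grad_injOn_vanishing hp h

theorem normalMat_mulVec_mem_normal (v : Vec) : normalMat.mulVec v ∈ normal := by
  intro x y hxy
  have h : (x : ℂ) ^ 2 + (y : ℂ) ^ 2 = 1 := by exact_mod_cast hxy
  simp [normalMat, Matrix.mulVec, dotProduct, Fin.sum_univ_two]
  generalize eval ![(x : ℂ), (y : ℂ)] (v 0) = a
  generalize eval ![(x : ℂ), (y : ℂ)] (v 1) = b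
  linear_combination (a * y - b * x) * h

/-- A normal field with constant curl is the gradient of a polynomial vanishing on the circle. -/
theorem exists_grad_of_curl_eq_C {f : Vec} (hf : f ∈ normal) {c : ℂ} (hc : curl f = C c) :
    c = 0 ∧ ∃ p ∈ vanishing, grad p = f := by
  have hr : curl ![-X 1, X 0] = C 2 := by
    rw [curl_apply, map_ofNat C 2]
    simp
    norm_num
  -- The rotation field has curl `2`, so subtracting `c / 2` times it leaves a curl-free field with
  -- tangential component `-c / 2` on the circle.
  obtain ⟨p, hp⟩ := exists_grad_eq_of_curl_eq_zero (f := f - (c / 2) • ![-X 1, X 0]) (by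
    rw [map_sub, map_smul, hr, hc, smul_eq_C_mul, ← C_mul, div_mul_cancel₀ _ two_ne_zero, sub_self])
  have key := eq_zero_of_tangential_eq (p := p) (c := -(c / 2)) (by
    intro x y hxy
    have h : (x : ℂ) ^ 2 + (y : ℂ) ^ 2 = 1 := by exact_mod_cast hxy
    have h1 := hf x y hxy
    rw [hp]
    simp [smul_eval]
    linear_combination h1 - c / 2 * h)
  have hc0 : c = 0 := by simpa using key.1
  refine ⟨hc0, p - C (eval ![1, 0] p), fun x y hxy => ?_, ?_⟩
  · rw [map_sub, eval_C, key.2 x y hxy, sub_self]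
  · rw [map_sub, hp, hc0]
    have : grad (C (eval ![1, 0] p)) = 0 := by funext i; simp [grad_apply]
    simp [this]

end Exactness

/-! ### Grouping an independent family by the fibres of a map. -/

section LinearAlgebra

variable {ι κ M : Type*} [AddCommGroup M] [Module ℂ M]

theorem iSupIndep_span_image_fiber {v : ι → M} (hv : LinearIndependent ℂ v) (φ : ι → κ) :
    iSupIndep fun k => Submodule.span ℂ (v '' (φ ⁻¹' {k})) := by
  intro k
  have h : ⨆ l, ⨆ _ : l ≠ k, Submodule.span ℂ (v '' (φ ⁻¹' {l})) ≤
      Submodule.span ℂ (v '' (φ ⁻¹' {k})ᶜ) := by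
    refine iSup₂_le fun l hl => Submodule.span_mono (Set.image_mono ?_)
    rintro i rfl
    exact hl
  exact (hv.disjoint_span_image disjoint_compl_right).mono_right h

theorem iSup_span_image_fiber (v : ι → M) (φ : ι → κ) :
    ⨆ k, Submodule.span ℂ (v '' (φ ⁻¹' {k})) = Submodule.span ℂ (Set.range v) := by
  rw [← Submodule.span_iUnion, ← Set.image_iUnion, ← Set.preimage_iUnion, Set.iUnion_of_singleton,
    Set.preimage_univ, Set.image_univ]

end LinearAlgebra

/-! ### Exactness of the pieces, the basis of normal fields, and the direct sums. -/

section Main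

open MvPolynomial

theorem wzernike_mem_vanishing (m : ℤ) (j : ℕ) : wzernike m j ∈ vanishing :=
  span_wzernike ▸ Submodule.subset_span ⟨(m, j), rfl⟩

theorem zernike_ne_zero (m : ℤ) (j : ℕ) : zernike m j ≠ 0 :=
  linearIndependent_zernike.ne_zero (m, j)

theorem zernike_zero_zero : zernike 0 0 = 1 := by
  simp [zernike, zernikeGen, harm, sjacobi_eq_sum]

theorem span_zernike_zero_zero : Submodule.span ℂ {zernike 0 0} =
    LinearMap.range (Algebra.linearMap ℂ Scal) := by
  rw [zernike_zero_zero]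
  ext p
  simp [Submodule.mem_span_singleton, Algebra.smul_def]

/-- The curl of `grad a + b u` is `b c z`, which vanishes only for `b = 0`; the gradient is
injective on polynomials vanishing on the circle. -/
theorem isExactSubcomplex_of {A : Submodule ℂ Scal} (hA : A ≤ vanishing) {u : Vec} {z : Scal}
    (hz : z ≠ 0) {c : ℂˣ} (hu : curl u = c • z) :
    IsExactSubcomplex A (A.map grad ⊔ Submodule.span ℂ {u}) (Submodule.span ℂ {z}) := by
  have h₁ : ∀ a ∈ A, grad a ∈ A.map grad ⊔ Submodule.span ℂ {u} := fun a ha =>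
    Submodule.mem_sup_left (Submodule.mem_map_of_mem ha)
  have hB : ∀ f ∈ A.map grad ⊔ Submodule.span ℂ {u},
      ∃ a ∈ A, ∃ b : ℂ, f = grad a + b • u ∧ curl f = (b * c) • z := by
    intro f hf
    obtain ⟨_, ⟨a, ha, rfl⟩, _, hb, rfl⟩ := Submodule.mem_sup.1 hf
    obtain ⟨b, rfl⟩ := Submodule.mem_span_singleton.1 hb
    refine ⟨a, ha, b, rfl, ?_⟩
    rw [map_add, curl_grad, zero_add, map_smul, hu, mul_smul]
    rfl
  have h₂ : ∀ f ∈ A.map grad ⊔ Submodule.span ℂ {u}, curl f ∈ Submodule.span ℂ {z} := by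
    intro f hf
    obtain ⟨a, -, b, -, hc⟩ := hB f hf
    exact Submodule.mem_span_singleton.2 ⟨_, hc.symm⟩
  refine ⟨h₁, h₂, ?_, ?_, ?_⟩
  · rw [injective_iff_map_eq_zero]
    rintro ⟨a, ha⟩ h
    exact Subtype.ext (grad_injOn_vanishing (hA ha) (congrArg Subtype.val h))
  · rintro ⟨f, hf⟩
    constructor
    · intro h
      obtain ⟨a, ha, b, hf', hc⟩ := hB f hf
      rw [show curl f = 0 from congrArg Subtype.val h] at hc
      have hb : b = 0 := by
        simpa [hz] using hc.symm
      exact ⟨⟨a, ha⟩, Subtype.ext (by simpa [hb] using hf'.symm)⟩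
    · rintro ⟨⟨a, ha⟩, h⟩
      refine Subtype.ext ?_
      rw [← h]
      exact curl_grad a
  · rintro ⟨q, hq⟩
    obtain ⟨d, rfl⟩ := Submodule.mem_span_singleton.1 hq
    refine ⟨⟨(d * ↑c⁻¹ : ℂ) • u, Submodule.mem_sup_right (Submodule.smul_mem _ _
      (Submodule.mem_span_singleton_self u))⟩, Subtype.ext ?_⟩
    change curl ((d * ↑c⁻¹ : ℂ) • u) = d • z
    rw [map_smul, hu, Units.smul_def, smul_smul, mul_assoc, Units.inv_mul, mul_one]

theorem span_nPlus_succ (m : ℤ) (j : ℕ) :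
    Submodule.span ℂ {nPlus m (j + 1)} = (Submodule.span ℂ {wzernike m j}).map grad := by
  have h : (-(1 / ((j : ℂ) + 1))) ≠ 0 :=
    neg_ne_zero.2 (one_div_ne_zero (Nat.cast_add_one_ne_zero j))
  rw [nPlus_succ, Submodule.map_span, Set.image_singleton,
    Submodule.span_singleton_smul_eq h.isUnit]

theorem isExactSubcomplex_main (m : ℤ) (j : ℕ) :
    IsExactSubcomplex (Submodule.span ℂ {wzernike m j})
      (Submodule.span ℂ {nPlus m (j + 1), nMinus m (j + 1)})
      (Submodule.span ℂ {zernike m (j + 1)}) := by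
  obtain ⟨c, hc⟩ := exists_curl_nMinus (m, j + 1) (by simp)
  rw [Submodule.span_insert, span_nPlus_succ]
  refine isExactSubcomplex_of ?_ (zernike_ne_zero _ _) hc
  rw [Submodule.span_singleton_le_iff_mem]
  exact wzernike_mem_vanishing m j

theorem isExactSubcomplex_extra {m : ℤ} (hm : m ≠ 0) :
    IsExactSubcomplex ⊥ (Submodule.span ℂ {nMinus m 0}) (Submodule.span ℂ {zernike m 0}) := by
  obtain ⟨c, hc⟩ := exists_curl_nMinus (m, 0) (by simpa using hm)
  have := isExactSubcomplex_of bot_le (zernike_ne_zero m 0) hc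
  rwa [Submodule.map_bot, bot_sup_eq] at this

theorem linearIndependent_nFamily : LinearIndependent ℂ nFamily := by
  have hplus : LinearIndependent ℂ fun p : ℤ × ℕ => nPlus p.1 (p.2 + 1) := by
    have h := (linearIndependent_wzernike.map
      (by rw [span_wzernike]; exact disjoint_vanishing_ker_grad)).units_smul
      fun p : ℤ × ℕ => Units.mk0 (-(1 / ((p.2 : ℂ) + 1)))
        (neg_ne_zero.2 (one_div_ne_zero (Nat.cast_add_one_ne_zero p.2)))
    have h' : (fun p : ℤ × ℕ => nPlus p.1 (p.2 + 1)) =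
        fun p : ℤ × ℕ => (-(1 / ((p.2 : ℂ) + 1))) • grad (wzernike p.1 p.2) :=
      funext fun p => nPlus_succ _ _
    rw [h']
    exact h
  choose c hc using fun p : {p : ℤ × ℕ // p ≠ (0, 0)} => exists_curl_nMinus p.1 p.2
  have hcurl : LinearIndependent ℂ
      (curl ∘ fun p : {p : ℤ × ℕ // p ≠ (0, 0)} => nMinus p.1.1 p.1.2) := by
    have h := (linearIndependent_zernike.comp _ Subtype.val_injective).units_smul c
    rwa [show curl ∘ (fun p : {p : ℤ × ℕ // p ≠ (0, 0)} => nMinus p.1.1 p.1.2) = _ from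
      funext hc]
  -- The two spans meet trivially: the curl kills the first and is injective on the second.
  refine linearIndependent_sum.2 ⟨hplus, hcurl.of_comp, Submodule.disjoint_def.2 ?_⟩
  intro f hf hf'
  have h0 : f ∈ LinearMap.ker curl := by
    refine (Submodule.span_le.2 ?_ : _ ≤ LinearMap.ker curl) hf
    rintro _ ⟨p, rfl⟩
    exact curl_nPlus_succ _ _
  obtain ⟨l, rfl⟩ := (Finsupp.mem_span_range_iff_exists_finsupp).1 hf'
  have hl : l = 0 := by
    refine linearIndependent_iff.1 hcurl l ?_
    rw [← Finsupp.apply_linearCombination]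
    exact h0
  simp [hl]

theorem nPlus_mem_normal (m : ℤ) (j : ℕ) : nPlus m j ∈ normal := by
  have h1 : n1 m j ∈ normal := normalMat_mulVec_mem_normal _
  have h2 : n2 m j ∈ normal := normalMat_mulVec_mem_normal _
  rw [nPlus]
  split_ifs
  · exact Submodule.smul_mem _ _ h1
  · exact Submodule.add_mem _ h1 h2

theorem nMinus_mem_normal (m : ℤ) (j : ℕ) : nMinus m j ∈ normal := by
  have h1 : n1 m j ∈ normal := normalMat_mulVec_mem_normal _
  have h2 : n2 m j ∈ normal := normalMat_mulVec_mem_normal _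
  rw [nMinus]
  split_ifs
  · exact Submodule.smul_mem _ _ h2
  · exact Submodule.smul_mem _ _ h1
  · exact Submodule.sub_mem _ h1 h2

theorem span_nFamily_le : Submodule.span ℂ (Set.range nFamily) ≤ normal := by
  refine Submodule.span_le.2 ?_
  rintro _ ⟨p | p, rfl⟩
  · exact nPlus_mem_normal _ _
  · exact nMinus_mem_normal _ _

theorem map_curl_span_nFamily_sup :
    (Submodule.span ℂ (Set.range nFamily)).map curl ⊔ Submodule.span ℂ {zernike 0 0} = ⊤ := by
  rw [eq_top_iff, ← span_zernike, Submodule.span_le]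
  rintro _ ⟨p, rfl⟩
  by_cases hp : p = (0, 0)
  · subst hp
    exact Submodule.mem_sup_right (Submodule.mem_span_singleton_self _)
  · obtain ⟨c, hc⟩ := exists_curl_nMinus p hp
    refine Submodule.mem_sup_left ⟨c⁻¹ • nMinus p.1 p.2, ?_, ?_⟩
    · exact Submodule.smul_mem _ (c⁻¹ : ℂˣ).1 (Submodule.subset_span ⟨Sum.inr ⟨p, hp⟩, rfl⟩)
    · rw [Units.smul_def, map_smul, hc, ← Units.smul_def, inv_smul_smul]

theorem mem_span_zernike_zero_zero {q : Scal} :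
    q ∈ Submodule.span ℂ {zernike 0 0} ↔ ∃ c : ℂ, q = C c := by
  rw [zernike_zero_zero, Submodule.mem_span_singleton]
  simp only [smul_eq_C_mul, mul_one, eq_comm]

theorem span_nFamily : Submodule.span ℂ (Set.range nFamily) = normal := by
  refine le_antisymm span_nFamily_le fun f hf => ?_
  -- Here `g` matches the curl of `f` up to a constant, so `f - g` is a normal field with constant
  -- curl.
  obtain ⟨_, ⟨g, hg, rfl⟩, q, hq, hfg⟩ := Submodule.mem_sup.1
    (map_curl_span_nFamily_sup.ge (Submodule.mem_top (x := curl f)))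
  obtain ⟨c, rfl⟩ := mem_span_zernike_zero_zero.1 hq
  obtain ⟨-, p, hp, hpf⟩ := exists_grad_of_curl_eq_C
    (normal.sub_mem hf (span_nFamily_le hg)) (c := c) (by rw [map_sub, ← hfg, add_sub_cancel_left])
  have hgrad : vanishing.map grad ≤ Submodule.span ℂ (Set.range nFamily) := by
    rw [← span_wzernike, Submodule.map_span, Submodule.span_le]
    rintro _ ⟨_, ⟨p, rfl⟩, rfl⟩
    have h : grad (wzernike p.1 p.2) ∈ (Submodule.span ℂ {wzernike p.1 p.2}).map grad :=
      Submodule.mem_map_of_mem (Submodule.mem_span_singleton_self _)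
    rw [← span_nPlus_succ] at h
    refine Submodule.span_mono ?_ h
    rw [Set.singleton_subset_iff]
    exact ⟨Sum.inl p, rfl⟩
  have := Submodule.add_mem _ (hgrad ⟨p, hp, hpf⟩) hg
  rwa [sub_add_cancel] at this

theorem isCompl_map_curl_normal :
    IsCompl (Submodule.map curl normal) (Submodule.span ℂ {zernike 0 0}) := by
  constructor
  · rw [Submodule.disjoint_def]
    rintro _ ⟨f, hf, rfl⟩ h
    obtain ⟨c, hc⟩ := mem_span_zernike_zero_zero.1 h
    rw [hc, (exists_grad_of_curl_eq_C hf hc).1, C_0]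
  · rw [codisjoint_iff, ← span_nFamily]
    exact map_curl_span_nFamily_sup

/-- The label of the sub-complex containing `n_{mj}^±`. -/
def nLabel : (ℤ × ℕ) ⊕ {p : ℤ × ℕ // p ≠ (0, 0)} → Piece
  | .inl (m, j) => .main m j
  | .inr ⟨(m, 0), h⟩ => .extra m fun hm => h (by rw [hm])
  | .inr ⟨(m, j + 1), _⟩ => .main m j

/-- The label of the sub-complex containing `z_{mj}`. -/
def zLabel : ℤ × ℕ → Piece
  | (m, 0) => if h : m = 0 then .const else .extra m h
  | (m, j + 1) => .main m j

/-- Writing the pieces as spans over the fibres of a label map lets independence and supremum be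
read off from the basis; `piece1_eq` and `piece2_eq` serve the same end. -/
theorem piece0_eq (k : Piece) : piece0 k =
    Submodule.span ℂ ((fun p : ℤ × ℕ => wzernike p.1 p.2) ''
      ((fun p : ℤ × ℕ => Piece.main p.1 p.2) ⁻¹' {k})) := by
  cases k with
  | main m j =>
    rw [piece0]
    congr 1
    ext q
    simp [eq_comm]
  | extra m hm =>
    have h : (fun p : ℤ × ℕ => Piece.main p.1 p.2) ⁻¹' {.extra m hm} = ∅ := by ext; simp
    rw [h, Set.image_empty, Submodule.span_empty]
    rfl
  | const =>
    have h : (fun p : ℤ × ℕ => Piece.main p.1 p.2) ⁻¹' {.const} = ∅ := by ext; simp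
    rw [h, Set.image_empty, Submodule.span_empty]
    rfl

theorem piece1_eq (k : Piece) :
    piece1 k = Submodule.span ℂ (nFamily '' (nLabel ⁻¹' {k})) := by
  cases k with
  | main m j =>
    have h : nLabel ⁻¹' {.main m j} = {Sum.inl (m, j), Sum.inr ⟨(m, j + 1), by simp⟩} := by
      ext (⟨m', j'⟩ | ⟨⟨m', _ | j'⟩, h⟩) <;> simp [nLabel]
    rw [h, Set.image_pair]
    rfl
  | extra m hm =>
    have h : nLabel ⁻¹' {.extra m hm} = {Sum.inr ⟨(m, 0), by simpa using hm⟩} := by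
      ext (⟨m', j'⟩ | ⟨⟨m', _ | j'⟩, h⟩) <;> simp [nLabel]
    rw [h, Set.image_singleton]
    rfl
  | const =>
    have h : nLabel ⁻¹' {.const} = ∅ := by
      ext (⟨m', j'⟩ | ⟨⟨m', _ | j'⟩, h⟩) <;> simp [nLabel]
    rw [h, Set.image_empty, Submodule.span_empty]
    rfl

theorem piece2_eq (k : Piece) :
    piece2 k = Submodule.span ℂ ((fun p : ℤ × ℕ => zernike p.1 p.2) '' (zLabel ⁻¹' {k})) := by
  cases k with
  | main m j =>
    have h : zLabel ⁻¹' {.main m j} = {(m, j + 1)} := by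
      ext ⟨m', _ | j'⟩ <;> simp [zLabel]
      split_ifs <;> simp
    rw [h, Set.image_singleton]
    rfl
  | extra m hm =>
    have h : zLabel ⁻¹' {.extra m hm} = {(m, 0)} := by
      ext ⟨m', _ | j'⟩ <;> simp [zLabel]
      split_ifs with h0
      · simpa [h0] using hm.symm
      · simp
    rw [h, Set.image_singleton]
    rfl
  | const =>
    have h : zLabel ⁻¹' {.const} = {(0, 0)} := by
      ext ⟨m', _ | j'⟩ <;> simp [zLabel]
    rw [h, Set.image_singleton]
    rfl

end Main

end

end DeRhamDisk

theorem mainTheorem3 :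
    -- for each mode `m` and each `j ≥ 0` an exact complex
    (∀ (m : ℤ) (j : ℕ), DeRhamDisk.IsExactSubcomplex
      (Submodule.span ℂ {DeRhamDisk.wzernike m j})
      (Submodule.span ℂ {DeRhamDisk.nPlus m (j + 1), DeRhamDisk.nMinus m (j + 1)})
      (Submodule.span ℂ {DeRhamDisk.zernike m (j + 1)})) ∧
    -- the additional exact complexes for `m ≠ 0`
    (∀ m : ℤ, m ≠ 0 → DeRhamDisk.IsExactSubcomplex
      ⊥
      (Submodule.span ℂ {DeRhamDisk.nMinus m 0})
      (Submodule.span ℂ {DeRhamDisk.zernike m 0})) ∧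
    -- the generators are bases of the three spaces of the polynomial de Rham complex
    ((LinearIndependent ℂ (fun p : ℤ × ℕ => DeRhamDisk.wzernike p.1 p.2) ∧
        Submodule.span ℂ (Set.range fun p : ℤ × ℕ => DeRhamDisk.wzernike p.1 p.2) =
          DeRhamDisk.vanishing) ∧
      (LinearIndependent ℂ DeRhamDisk.nFamily ∧
        Submodule.span ℂ (Set.range DeRhamDisk.nFamily) = DeRhamDisk.normal) ∧
      (LinearIndependent ℂ (fun p : ℤ × ℕ => DeRhamDisk.zernike p.1 p.2) ∧
        Submodule.span ℂ (Set.range fun p : ℤ × ℕ => DeRhamDisk.zernike p.1 p.2) = ⊤)) ∧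
    -- the polynomial de Rham complex is the direct sum of these complexes and the constants
    ((iSupIndep DeRhamDisk.piece0 ∧ ⨆ p, DeRhamDisk.piece0 p = DeRhamDisk.vanishing) ∧
      (iSupIndep DeRhamDisk.piece1 ∧ ⨆ p, DeRhamDisk.piece1 p = DeRhamDisk.normal) ∧
      (iSupIndep DeRhamDisk.piece2 ∧ ⨆ p, DeRhamDisk.piece2 p = ⊤)) ∧
    -- `z_{00}` spans the constants, which are exactly what the range of the curl misses
    (Submodule.span ℂ {DeRhamDisk.zernike 0 0} =
        LinearMap.range (Algebra.linearMap ℂ DeRhamDisk.Scal) ∧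
      IsCompl (Submodule.map DeRhamDisk.curl DeRhamDisk.normal)
        (Submodule.span ℂ {DeRhamDisk.zernike 0 0})) := by
  open DeRhamDisk in
  refine ⟨isExactSubcomplex_main, fun m hm => isExactSubcomplex_extra hm,
    ⟨⟨linearIndependent_wzernike, span_wzernike⟩, ⟨linearIndependent_nFamily, span_nFamily⟩,
      linearIndependent_zernike, span_zernike⟩, ⟨⟨?_, ?_⟩, ⟨?_, ?_⟩, ?_, ?_⟩,
    span_zernike_zero_zero, isCompl_map_curl_normal⟩
  · rw [funext piece0_eq]
    exact iSupIndep_span_image_fiber linearIndependent_wzernike _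
  · rw [funext piece0_eq, iSup_span_image_fiber, span_wzernike]
  · rw [funext piece1_eq]
    exact iSupIndep_span_image_fiber linearIndependent_nFamily _
  · rw [funext piece1_eq, iSup_span_image_fiber, span_nFamily]
  · rw [funext piece2_eq]
    exact iSupIndep_span_image_fiber linearIndependent_zernike _
  · rw [funext piece2_eq, iSup_span_image_fiber, span_zernike]
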